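/- Let $k$ be a positive integer. A $k$-graph is a countable small category $\Lambda$ (vertex set $\Lambda^0$, range and source maps $r,s$) with a functor $d:\Lambda\to\mathbb N^k$ such that every $\lambda$ with $d(\lambda)=m+n$ factors uniquely as $\lambda=\mu\nu$ with $d(\mu)=m$, $d(\nu)=n$. Write $v\Lambda^n=\{\lambda: r(\lambda)=v,\ d(\lambda)=n\}$. Assume that $\Lambda$ is row-finite without sources: each $v\Lambda^n$ ($v\in\Lambda^0$, $n\in\mathbb N^k$) is finite and nonempty. The talented monoid $T_\Lambda$ is the commutative monoid generated by the symbols $v(n)$ ($v\in\Lambda^0$, $n\in\mathbb Z^k$) subject to the relations $v(n)=\sum_{\alpha\in v\Lambda^{e_i}}s(\alpha)(n+e_i)$ for all $v$, $n$ and $1\le i\le k$ (with $v\Lambda^{e_i}\neq\emptyset$), where $e_i$ is the $i$-th standard generator of $\mathbb N^k$; $\mathbb Z^k$ acts on it by ${}^m v(n)=v(n+m)$. Let $\Lambda^\infty$ be the set of degree-preserving functors $x:\Omega_k\to\Lambda$, where $\Omega_k$ is the $k$-graph $\{(m,n)\in\mathbb N^k\times\mathbb N^k: m\le n\}$ with $r(m,n)=m$,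 $s(m,n)=n$, $d(m,n)=n-m$; let $r(x)=x(0)$ and $\sigma^p(x)(m,n)=x(m+p,n+p)$. The path groupoid is $\mathcal G_\Lambda=\{(x,p-q,y): x,y\in\Lambda^\infty,\ p,q\in\mathbb N^k,\ \sigma^p(x)=\sigma^q(y)\}$, where $(x,n,y)$ has range $x$ and source $y$, $(x,n,y)(y,m,w)=(x,n+m,w)$ and $(x,n,y)^{-1}=(y,-n,x)$. Its topology is generated by the sets $Z(\lambda,\mu)=\{(\lambda z,d(\lambda)-d(\mu),\mu z): z\in\Lambda^\infty,\ r(z)=s(\lambda)\}$ with $s(\lambda)=s(\mu)$. Put $c(x,n,y)=n$ and $Z(v)=Z(v,v)$. The skew product $\mathcal G_\Lambda\times_c\mathbb Z^k$ is the groupoid with arrows $(g,\alpha)\in\mathcal G_\Lambda\times\mathbb Z^k$ (product topology, $\mathbb Z^k$ discrete), range $(r(g),\alpha)$, source $(s(g),\alpha+c(g))$, and product $(g,\alpha)(h,\alpha+c(g))=(gh,\alpha)$. For a topological groupoid $\mathcal G$ of this kind, a compact open bisection is a compact open set of arrows on which $r$ and $s$ are injective. $\operatorname{Typ}(\mathcal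 G)$ is the commutative monoid generated by symbols $\operatorname{typ}(U)$, one for each idempotent compact open bisection $U$ (equivalently, each compact open set $U$ of units), subject to: $\operatorname{typ}(\emptyset)=0$; $\operatorname{typ}(W^{-1}W)=\operatorname{typ}(WW^{-1})$ for every compact open bisection $W$; and $\operatorname{typ}(U\sqcup V)=\operatorname{typ}(U)+\operatorname{typ}(V)$ for orthogonal (i.e. disjoint) $U,V$. The group $\mathbb Z^k$ acts on $\operatorname{Typ}(\mathcal G_\Lambda\times_c\mathbb Z^k)$ by ${}^m\operatorname{typ}(U\times\{n\})=\operatorname{typ}(U\times\{n+m\})$. **Theorem.** For every row-finite $k$-graph $\Lambda$ without sources there is an isomorphism of commutative monoids $\varphi:T_\Lambda\to\operatorname{Typ}(\mathcal G_\Lambda\times_c\mathbb Z^k)$ that commutes with the $\mathbb Z^k$-actions and satisfies $\varphi(v(n))=\operatorname{typ}(Z(v)\times\{n\})$ for all $v\in\Lambda^0$, $n\in\mathbb Z^k$; in particular the sets $Z(v)\times\{n\}$ are compact open sets of units. Moreover $T_\Lambda$ is conical (if $a+b=0$ then $a=0$) and a refinement monoid (if $a+b=c+d$, there are $z_1,z_2,z_3,z_4\in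 T_\Lambda$ with $a=z_1+z_2$, $b=z_3+z_4$, $c=z_1+z_3$, $d=z_2+z_4$). -/

import Mathlib

open CategoryTheory

universe u v w

namespace HRG

/-! ### Arrows of a category -/

/-- The type of all arrows of a category, bundled with their source and range. -/
@[ext]
structure CatArrow (C : Type u) [Category.{v} C] where
  /-- the source (domain) of the arrow -/
  src : C
  /-- the range (codomain) of the arrow -/
  rng : C
  /-- the arrow itself -/
  hom : src ⟶ rng

/-! ### Commutative monoids given by generators and relations -/

section Presented

variable {G : Type u}

/-- The commutative monoid generated by `G` subject to the relations `R`: the quotient of the free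
commutative monoid `G →₀ ℕ` by the congruence generated by `R`. -/
def Presented (R : (G →₀ ℕ) → (G →₀ ℕ) → Prop) : Type u := (addConGen R).Quotient

noncomputable instance (R : (G →₀ ℕ) → (G →₀ ℕ) → Prop) : AddCommMonoid (Presented R) :=
  inferInstanceAs (AddCommMonoid (addConGen R).Quotient)

/-- The quotient map from the free commutative monoid. -/
noncomputable def Presented.mk (R : (G →₀ ℕ) → (G →₀ ℕ) → Prop) : (G →₀ ℕ) →+ Presented R :=
  (addConGen R).mk'

/-- The class of a generator. -/
noncomputable def Presented.of (R : (G →₀ ℕ) → (G →₀ ℕ) → Prop) (g : G) : Presented R :=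
  Presented.mk R (Finsupp.single g 1)

theorem Presented.mk_surjective (R : (G →₀ ℕ) → (G →₀ ℕ) → Prop) :
    Function.Surjective (Presented.mk R) := AddCon.mk'_surjective

/-- If a group acts on the generators and preserves the relations, each group element induces an
endomorphism of the presented monoid. -/
noncomputable def Presented.actHom {M : Type v} [Monoid M] [MulAction M G]
    (R : (G →₀ ℕ) → (G →₀ ℕ) → Prop)
    (hR : ∀ (m : M) (x y : G →₀ ℕ), R x y →
      R (Finsupp.mapDomain (m • ·) x) (Finsupp.mapDomain (m • ·) y)) (m : M) :
    Presented R →+ Presented R :=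
  (addConGen R).lift ((Presented.mk R).comp (Finsupp.mapDomain.addMonoidHom (m • ·))) <| by
    refine AddCon.addConGen_le.2 fun x y h => ?_
    refine (AddCon.eq _).2 ?_
    exact AddConGen.Rel.of _ _ (hR m x y h)

theorem Presented.actHom_mk {M : Type v} [Monoid M] [MulAction M G]
    (R : (G →₀ ℕ) → (G →₀ ℕ) → Prop)
    (hR : ∀ (m : M) (x y : G →₀ ℕ), R x y →
      R (Finsupp.mapDomain (m • ·) x) (Finsupp.mapDomain (m • ·) y)) (m : M) (x : G →₀ ℕ) :
    Presented.actHom R hR m (Presented.mk R x)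
      = Presented.mk R (Finsupp.mapDomain (m • ·) x) := rfl

/-- The action by monoid endomorphisms (automorphisms, if `M` is a group) obtained by extending an
action on the generators linearly. -/
@[reducible]
noncomputable def Presented.distribMulAction {M : Type v} [Monoid M] [MulAction M G]
    (R : (G →₀ ℕ) → (G →₀ ℕ) → Prop)
    (hR : ∀ (m : M) (x y : G →₀ ℕ), R x y →
      R (Finsupp.mapDomain (m • ·) x) (Finsupp.mapDomain (m • ·) y)) :
    DistribMulAction M (Presented R) where
  smul m := Presented.actHom R hR m
  one_smul a := by
    obtain ⟨x, rfl⟩ := Presented.mk_surjective R a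
    change Presented.actHom R hR 1 _ = _
    rw [Presented.actHom_mk]
    have : ((1 : M) • · : G → G) = id := by ext; simp
    rw [this, Finsupp.mapDomain_id]
  mul_smul m n a := by
    obtain ⟨x, rfl⟩ := Presented.mk_surjective R a
    change Presented.actHom R hR (m * n) _
      = Presented.actHom R hR m (Presented.actHom R hR n _)
    simp only [Presented.actHom_mk]
    rw [← Finsupp.mapDomain_comp]
    have : ((m * n) • · : G → G) = (m • ·) ∘ (n • ·) := by ext; simp [mul_smul]
    rw [this]
  smul_zero m := map_zero (Presented.actHom R hR m)
  smul_add m := map_add (Presented.actHom R hR m)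

end Presented

/-- A commutative monoid is conical if `0` is its only unit. -/
def IsConical (M : Type u) [AddCommMonoid M] : Prop :=
  ∀ a : M, (∃ b : M, a + b = 0) → a = 0

/-- A commutative monoid is a refinement monoid if any equality `a + b = c + d` has a common
refinement. -/
def IsRefinement (M : Type u) [AddCommMonoid M] : Prop :=
  ∀ a b c d : M, a + b = c + d → ∃ z₁ z₂ z₃ z₄ : M,
    a = z₁ + z₂ ∧ b = z₃ + z₄ ∧ c = z₁ + z₃ ∧ d = z₂ + z₄

/-! ### The type monoid of a topological groupoid -/

section Groupoid

variable (X : Type u) [Groupoid.{v} X]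

/-- The set of units (identity arrows) of a groupoid. -/
def units : Set (CatArrow X) := {g | ∃ x : X, g = ⟨x, x, 𝟙 x⟩}

variable {X}

/-- The set product `AB = {ab | a ∈ A, b ∈ B, s(a) = r(b)}`. In Mathlib's notation the product `ab`
(first `b`, then `a`) is `b ≫ a`. -/
def setMul (A B : Set (CatArrow X)) : Set (CatArrow X) :=
  {g | ∃ (x y z : X) (a : y ⟶ z) (b : x ⟶ y),
    (⟨y, z, a⟩ : CatArrow X) ∈ A ∧ (⟨x, y, b⟩ : CatArrow X) ∈ B ∧ g = ⟨x, z, b ≫ a⟩}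

/-- The set of inverses `A⁻¹ = {a⁻¹ | a ∈ A}`. -/
def setInv (A : Set (CatArrow X)) : Set (CatArrow X) :=
  {g | ∃ a ∈ A, g = ⟨a.rng, a.src, Groupoid.inv a.hom⟩}

/-- Compact open bisections: compact open sets of arrows on which source and range are injective. -/
structure IsCompactOpenBisection [TopologicalSpace (CatArrow X)] (W : Set (CatArrow X)) : Prop where
  isCompact : IsCompact W
  isOpen : IsOpen W
  injOn_src : Set.InjOn CatArrow.src W
  injOn_rng : Set.InjOn CatArrow.rng W

variable (X) in
/-- The idempotents of the inverse semigroup of compact open bisections. -/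
@[ext]
structure Idem [TopologicalSpace (CatArrow X)] where
  /-- the underlying set of arrows -/
  carrier : Set (CatArrow X)
  isCompactOpenBisection : IsCompactOpenBisection carrier
  mul_self : setMul carrier carrier = carrier

/-- The idempotents among the sets of arrows on which source and range are injective are exactly
the sets of units. Hence `Idem X` consists of the compact open sets of units. -/
theorem setMul_self_iff {W : Set (CatArrow X)} (hs : Set.InjOn CatArrow.src W)
    (hr : Set.InjOn CatArrow.rng W) : setMul W W = W ↔ W ⊆ units X := by
  constructor
  · intro h g hg
    have hg' := hg
    rw [← h] at hg
    obtain ⟨x, y, z, a, b, ha, hb, rfl⟩ := hg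
    have h1 := hr ha hg' rfl
    have h2 := hs hb hg' rfl
    simp only [CatArrow.mk.injEq, true_and] at h1 h2
    obtain ⟨rfl, h1⟩ := h1
    obtain ⟨rfl, h2⟩ := h2
    have h1 : a = b ≫ a := eq_of_heq h1
    have h2 : b = b ≫ a := eq_of_heq h2
    have h3 : b ≫ a = 𝟙 y ≫ a := by rw [Category.id_comp, ← h1]
    have h4 : b = 𝟙 y := (cancel_mono a).1 h3
    exact ⟨y, by rw [← h2, h4]⟩
  · intro h
    ext g
    constructor
    · rintro ⟨x, y, z, a, b, ha, hb, rfl⟩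
      obtain ⟨t, ht⟩ := h ha
      simp only [CatArrow.mk.injEq] at ht
      obtain ⟨rfl, rfl, ht⟩ := ht
      obtain rfl := eq_of_heq ht
      rwa [Category.comp_id]
    · intro hg
      obtain ⟨t, rfl⟩ := h hg
      exact ⟨t, t, t, 𝟙 t, 𝟙 t, hg, hg, by rw [Category.comp_id]⟩

variable (X) in
/-- The defining relations of the type monoid of the inverse semigroup of compact open bisections.
The zero element is the empty set, the involution is `W ↦ W⁻¹`, and the join of two orthogonal
elements is their (disjoint) union. -/
inductive TypRel [TopologicalSpace (CatArrow X)] : (Idem X →₀ ℕ) → (Idem X →₀ ℕ) → Prop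
  | zero (x : Idem X) (hx : x.carrier = ∅) : TypRel (Finsupp.single x 1) 0
  | equiv (x y : Idem X) (W : Set (CatArrow X)) (hW : IsCompactOpenBisection W)
      (hx : x.carrier = setMul (setInv W) W) (hy : y.carrier = setMul W (setInv W)) :
      TypRel (Finsupp.single x 1) (Finsupp.single y 1)
  | join (x y z : Idem X) (hxy : setMul (setInv x.carrier) y.carrier = ∅)
      (hxy' : setMul x.carrier (setInv y.carrier) = ∅) (hz : z.carrier = x.carrier ∪ y.carrier) :
      TypRel (Finsupp.single z 1) (Finsupp.single x 1 + Finsupp.single y 1)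

variable (X) in
/-- The type monoid of a topological groupoid, i.e. the type monoid of the inverse semigroup of its
compact open bisections. -/
abbrev TypeMonoid [TopologicalSpace (CatArrow X)] := Presented (TypRel X)

/-- The generator `typ(x)` of the type monoid. -/
noncomputable def typ [TopologicalSpace (CatArrow X)] (x : Idem X) : TypeMonoid X :=
  Presented.of (TypRel X) x

end Groupoid

/-! ### Skew products and the graded type monoid -/

/-- A cocycle on a groupoid with values in a commutative group, written additively:
`c(gf) = c(g) + c(f)`. -/
structure Cocycle (X : Type u) [Groupoid.{v} X] (Γ : Type w) [AddCommGroup Γ] where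
  /-- the value of the cocycle on an arrow -/
  toFun : ∀ {x y : X}, (x ⟶ y) → Γ
  map_comp : ∀ {x y z : X} (f : x ⟶ y) (g : y ⟶ z), toFun (f ≫ g) = toFun g + toFun f

section Skew

variable {X : Type u} [Groupoid.{v} X] {Γ : Type w} [AddCommGroup Γ]

theorem Cocycle.map_id (c : Cocycle X Γ) (x : X) : c.toFun (𝟙 x) = 0 := by
  have := c.map_comp (𝟙 x) (𝟙 x)
  rw [Category.comp_id] at this
  simpa using this

theorem Cocycle.map_inv (c : Cocycle X Γ) {x y : X} (f : x ⟶ y) :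
    c.toFun (Groupoid.inv f) = - c.toFun f := by
  have := c.map_comp f (Groupoid.inv f)
  rw [Groupoid.comp_inv, c.map_id] at this
  exact eq_neg_of_add_eq_zero_left this.symm

/-- The unit space `X × Γ` of the skew product groupoid. -/
@[ext]
structure SkewProduct (c : Cocycle X Γ) where
  /-- the unit of the original groupoid -/
  base : X
  /-- the level in the group -/
  level : Γ

/-- The skew product groupoid. The arrow `(g, α)` has range `(r(g), α)` and source
`(s(g), α + c(g))`. -/
instance (c : Cocycle X Γ) : Groupoid (SkewProduct c) where
  Hom A B := {g : A.base ⟶ B.base // A.level = B.level + c.toFun g}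
  id A := ⟨𝟙 A.base, by rw [c.map_id, add_zero]⟩
  comp f g := ⟨f.1 ≫ g.1, by rw [c.map_comp, ← add_assoc, ← g.2, ← f.2]⟩
  id_comp f := Subtype.ext (Category.id_comp f.1)
  comp_id f := Subtype.ext (Category.comp_id f.1)
  assoc f g h := Subtype.ext (Category.assoc f.1 g.1 h.1)
  inv f := ⟨Groupoid.inv f.1, by
    rw [c.map_inv]
    exact eq_add_neg_of_add_eq f.2.symm⟩
  inv_comp f := Subtype.ext (Groupoid.inv_comp f.1)
  comp_inv f := Subtype.ext (Groupoid.comp_inv f.1)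

/-- The arrows of the skew product are the pairs `(g, α)`. -/
def skewArrowEquiv (c : Cocycle X Γ) : CatArrow (SkewProduct c) ≃ CatArrow X × Γ where
  toFun a := (⟨a.src.base, a.rng.base, a.hom.1⟩, a.rng.level)
  invFun p := ⟨⟨p.1.src, p.2 + c.toFun p.1.hom⟩, ⟨p.1.rng, p.2⟩, ⟨p.1.hom, rfl⟩⟩
  left_inv a := by
    obtain ⟨⟨x, α⟩, ⟨y, β⟩, g⟩ := a
    obtain ⟨g, h⟩ := g
    change x ⟶ y at g
    change α = β + c.toFun g at h
    subst h
    rfl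
  right_inv p := rfl

/-- The product topology on the arrows of the skew product, where the group is discrete. -/
instance [TopologicalSpace (CatArrow X)] (c : Cocycle X Γ) :
    TopologicalSpace (CatArrow (SkewProduct c)) :=
  letI : TopologicalSpace Γ := ⊥
  TopologicalSpace.induced (skewArrowEquiv c) inferInstance

/-- The set of arrows `U × {α}` in the skew product. -/
def atLevel (c : Cocycle X Γ) (U : Set (CatArrow X)) (α : Γ) : Set (CatArrow (SkewProduct c)) :=
  {a | (skewArrowEquiv c a).1 ∈ U ∧ (skewArrowEquiv c a).2 = α}

/-- The translation `(g, α) ↦ (g, γ + α)` of the arrows of the skew product. -/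
def translate (c : Cocycle X Γ) (γ : Γ) (a : CatArrow (SkewProduct c)) :
    CatArrow (SkewProduct c) :=
  ⟨⟨a.src.base, γ + a.src.level⟩, ⟨a.rng.base, γ + a.rng.level⟩,
    ⟨a.hom.1, by rw [add_assoc, ← a.hom.2]⟩⟩

theorem skewArrowEquiv_translate (c : Cocycle X Γ) (γ : Γ) (a : CatArrow (SkewProduct c)) :
    skewArrowEquiv c (translate c γ a) = ((skewArrowEquiv c a).1, γ + (skewArrowEquiv c a).2) :=
  rfl

theorem translate_zero (c : Cocycle X Γ) (a : CatArrow (SkewProduct c)) :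
    translate c 0 a = a := by
  apply (skewArrowEquiv c).injective
  rw [skewArrowEquiv_translate, zero_add]

theorem translate_add (c : Cocycle X Γ) (γ δ : Γ) (a : CatArrow (SkewProduct c)) :
    translate c (γ + δ) a = translate c γ (translate c δ a) := by
  apply (skewArrowEquiv c).injective
  simp only [skewArrowEquiv_translate, add_assoc]

theorem translate_neg_translate (c : Cocycle X Γ) (γ : Γ) (a : CatArrow (SkewProduct c)) :
    translate c (-γ) (translate c γ a) = a := by
  rw [← translate_add, neg_add_cancel, translate_zero]

theorem translate_translate_neg (c : Cocycle X Γ) (γ : Γ) (a : CatArrow (SkewProduct c)) :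
    translate c γ (translate c (-γ) a) = a := by
  rw [← translate_add, add_neg_cancel, translate_zero]

theorem continuous_translate [TopologicalSpace (CatArrow X)] (c : Cocycle X Γ) (γ : Γ) :
    Continuous (translate c γ) := by
  let _ : TopologicalSpace Γ := ⊥
  have _ : DiscreteTopology Γ := ⟨rfl⟩
  refine continuous_induced_rng.2 ?_
  have h : Continuous (fun p : CatArrow X × Γ => (p.1, γ + p.2)) :=
    continuous_fst.prodMk ((continuous_of_discreteTopology (f := fun x : Γ => γ + x)).comp
      continuous_snd)
  have h' : Continuous (skewArrowEquiv c) := continuous_induced_dom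
  exact h.comp h'

theorem image_translate_eq (c : Cocycle X Γ) (γ : Γ) (A : Set (CatArrow (SkewProduct c))) :
    translate c γ '' A = translate c (-γ) ⁻¹' A :=
  congrFun (Set.image_eq_preimage_of_inverse (translate_neg_translate c γ)
    (translate_translate_neg c γ)) A

theorem image_translate_setMul (c : Cocycle X Γ) (γ : Γ) (A B : Set (CatArrow (SkewProduct c))) :
    translate c γ '' setMul A B = setMul (translate c γ '' A) (translate c γ '' B) := by
  have key : ∀ (δ : Γ) (A B : Set (CatArrow (SkewProduct c))),
      translate c δ '' setMul A B ⊆ setMul (translate c δ '' A) (translate c δ '' B) := by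
    rintro δ A B _ ⟨_, ⟨x, y, z, a, b, ha, hb, rfl⟩, rfl⟩
    exact ⟨_, _, _, _, _, ⟨_, ha, rfl⟩, ⟨_, hb, rfl⟩, rfl⟩
  refine (key γ A B).antisymm ?_
  intro g hg
  have h := key (-γ) _ _ ⟨g, hg, rfl⟩
  rw [Set.image_image, Set.image_image] at h
  simp only [translate_neg_translate, Set.image_id'] at h
  exact ⟨_, h, translate_translate_neg c γ g⟩

theorem image_translate_setInv (c : Cocycle X Γ) (γ : Γ) (A : Set (CatArrow (SkewProduct c))) :
    translate c γ '' setInv A = setInv (translate c γ '' A) := by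
  ext g
  constructor
  · rintro ⟨_, ⟨a, ha, rfl⟩, rfl⟩
    exact ⟨_, ⟨a, ha, rfl⟩, rfl⟩
  · rintro ⟨_, ⟨a, ha, rfl⟩, rfl⟩
    exact ⟨_, ⟨a, ha, rfl⟩, rfl⟩

theorem IsCompactOpenBisection.image_translate [TopologicalSpace (CatArrow X)] {c : Cocycle X Γ}
    {W : Set (CatArrow (SkewProduct c))} (hW : IsCompactOpenBisection W) (γ : Γ) :
    IsCompactOpenBisection (translate c γ '' W) where
  isCompact := hW.isCompact.image (continuous_translate c γ)
  isOpen := by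
    rw [image_translate_eq]
    exact hW.isOpen.preimage (continuous_translate c _)
  injOn_src := by
    rintro _ ⟨a, ha, rfl⟩ _ ⟨b, hb, rfl⟩ h
    have h' : a.src.base = b.src.base ∧ γ + a.src.level = γ + b.src.level :=
      (SkewProduct.ext_iff).1 h
    rw [hW.injOn_src ha hb (SkewProduct.ext h'.1 (add_left_cancel h'.2))]
  injOn_rng := by
    rintro _ ⟨a, ha, rfl⟩ _ ⟨b, hb, rfl⟩ h
    have h' : a.rng.base = b.rng.base ∧ γ + a.rng.level = γ + b.rng.level :=
      (SkewProduct.ext_iff).1 h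
    rw [hW.injOn_rng ha hb (SkewProduct.ext h'.1 (add_left_cancel h'.2))]

/-- The action of the group on the compact open sets of units of the skew product, which maps
`U × {α}` to `U × {γ + α}`. -/
instance [TopologicalSpace (CatArrow X)] (c : Cocycle X Γ) :
    MulAction (Multiplicative Γ) (Idem (SkewProduct c)) where
  smul γ x := ⟨translate c γ.toAdd '' x.carrier, x.isCompactOpenBisection.image_translate _, by
    rw [← image_translate_setMul, x.mul_self]⟩
  one_smul x := Idem.ext <| by
    change translate c 0 '' x.carrier = x.carrier
    simp only [translate_zero, Set.image_id']
  mul_smul γ δ x := Idem.ext <| by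
    change translate c (γ.toAdd + δ.toAdd) '' x.carrier
      = translate c γ.toAdd '' (translate c δ.toAdd '' x.carrier)
    rw [Set.image_image]
    simp only [translate_add]

theorem Idem.carrier_smul [TopologicalSpace (CatArrow X)] {c : Cocycle X Γ}
    (γ : Multiplicative Γ) (x : Idem (SkewProduct c)) :
    (γ • x).carrier = translate c γ.toAdd '' x.carrier := rfl

/-- The action maps `U × {α}` to `U × {γ + α}`. -/
theorem image_translate_atLevel (c : Cocycle X Γ) (γ α : Γ) (U : Set (CatArrow X)) :
    translate c γ '' atLevel c U α = atLevel c U (γ + α) := by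
  rw [image_translate_eq]
  ext a
  simp only [atLevel, Set.mem_preimage, Set.mem_ofPred_eq, skewArrowEquiv_translate]
  refine and_congr_right fun _ => ?_
  rw [neg_add_eq_iff_eq_add]

theorem typRel_smul [TopologicalSpace (CatArrow X)] (c : Cocycle X Γ) (γ : Multiplicative Γ)
    (a b : Idem (SkewProduct c) →₀ ℕ) (h : TypRel (SkewProduct c) a b) :
    TypRel (SkewProduct c) (Finsupp.mapDomain (γ • ·) a) (Finsupp.mapDomain (γ • ·) b) := by
  cases h with
  | zero x hx =>
    rw [Finsupp.mapDomain_single, Finsupp.mapDomain_zero]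
    exact TypRel.zero _ (by rw [Idem.carrier_smul, hx, Set.image_empty])
  | equiv x y W hW hx hy =>
    rw [Finsupp.mapDomain_single, Finsupp.mapDomain_single]
    refine TypRel.equiv _ _ (translate c γ.toAdd '' W) (hW.image_translate _) ?_ ?_
    · rw [Idem.carrier_smul, hx, image_translate_setMul, image_translate_setInv]
    · rw [Idem.carrier_smul, hy, image_translate_setMul, image_translate_setInv]
  | join x y z h1 h2 hz =>
    rw [Finsupp.mapDomain_add]
    simp only [Finsupp.mapDomain_single]
    refine TypRel.join _ _ _ ?_ ?_ ?_
    · rw [Idem.carrier_smul, Idem.carrier_smul, ← image_translate_setInv,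
        ← image_translate_setMul, h1, Set.image_empty]
    · rw [Idem.carrier_smul, Idem.carrier_smul, ← image_translate_setInv,
        ← image_translate_setMul, h2, Set.image_empty]
    · rw [Idem.carrier_smul, hz, Set.image_union, Idem.carrier_smul, Idem.carrier_smul]

/-- The graded type monoid of a groupoid graded by a cocycle: the type monoid of the skew product. -/
abbrev GradedTypeMonoid [TopologicalSpace (CatArrow X)] (c : Cocycle X Γ) :=
  TypeMonoid (SkewProduct c)

/-- The graded type monoid is a `Γ`-monoid, where `γ` maps `typ(U × {α})` to
`typ(U × {γ + α})`. -/
noncomputable instance [TopologicalSpace (CatArrow X)] (c : Cocycle X Γ) :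
    DistribMulAction (Multiplicative Γ) (GradedTypeMonoid c) :=
  Presented.distribMulAction (TypRel (SkewProduct c)) (typRel_smul c)

end Skew

/-! ### Higher-rank graphs -/

/-- A `k`-graph: a countable small category with a degree functor to `ℕ^k` which has the unique
factorization property. Objects are called vertices and arrows are called paths. The product `λμ`
of paths with `s(λ) = r(μ)` is `μ ≫ λ` in Mathlib's notation. -/
structure KGraph (k : ℕ) where
  /-- the vertices -/
  Obj : Type u
  /-- the category of paths -/
  [cat : SmallCategory.{u} Obj]
  /-- there are countably many paths, hence also countably many vertices -/
  countable : Countable (CatArrow Obj)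
  /-- the degree functor -/
  degree : ∀ {x y : Obj}, (x ⟶ y) → (Fin k → ℕ)
  degree_id : ∀ x : Obj, degree (𝟙 x) = 0
  degree_comp : ∀ {x y z : Obj} (f : x ⟶ y) (g : y ⟶ z), degree (f ≫ g) = degree g + degree f
  factorization : ∀ {x y : Obj} (f : x ⟶ y) (m n : Fin k → ℕ), degree f = m + n →
    ∃! p : (Σ z : Obj, (z ⟶ y) × (x ⟶ z)),
      p.2.2 ≫ p.2.1 = f ∧ degree p.2.1 = m ∧ degree p.2.2 = n

namespace KGraph

variable {k : ℕ} (Λ : KGraph.{u} k)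

instance : SmallCategory Λ.Obj := Λ.cat

/-- The paths of a `k`-graph. -/
abbrev Path := CatArrow Λ.Obj

/-- The degree of a path. -/
def deg (α : Λ.Path) : Fin k → ℕ := Λ.degree α.hom

/-- A vertex regarded as a path of degree zero. -/
def vertexPath (x : Λ.Obj) : Λ.Path := ⟨x, x, 𝟙 x⟩

/-- The set `vΛⁿ` of paths of degree `n` with range `v`. -/
def pathsTo (x : Λ.Obj) (n : Fin k → ℕ) : Set Λ.Path := {α | α.rng = x ∧ Λ.deg α = n}

/-- Row-finiteness: every `vΛⁿ` is finite. -/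
def RowFinite : Prop := ∀ (x : Λ.Obj) (n : Fin k → ℕ), (Λ.pathsTo x n).Finite

/-- No sources: every `vΛⁿ` is nonempty. -/
def NoSources : Prop := ∀ (x : Λ.Obj) (n : Fin k → ℕ), (Λ.pathsTo x n).Nonempty

/-! ### The talented monoid -/

/-- The defining relations `v(n) = ∑_{α ∈ vΛ^{e_i}} s(α)(n + e_i)` of the talented monoid, for all
`v`, `n` and `i` such that `vΛ^{e_i}` is (finite and) nonempty. -/
inductive TalentedRel :
    (Λ.Obj × (Fin k → ℤ) →₀ ℕ) → (Λ.Obj × (Fin k → ℤ) →₀ ℕ) → Prop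
  | rel (x : Λ.Obj) (n : Fin k → ℤ) (i : Fin k) (S : Finset Λ.Path)
      (hS : (S : Set Λ.Path) = Λ.pathsTo x (Pi.single i 1)) (hne : S.Nonempty) :
      TalentedRel (Finsupp.single (x, n) 1)
        (∑ α ∈ S, Finsupp.single (α.src, n + Pi.single i 1) 1)

/-- The talented monoid of a (row-finite) `k`-graph. -/
abbrev TalentedMonoid := Presented Λ.TalentedRel

/-- The generator `v(n)` of the talented monoid. -/
noncomputable def gen (x : Λ.Obj) (n : Fin k → ℤ) : Λ.TalentedMonoid :=
  Presented.of Λ.TalentedRel (x, n)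

/-- The action of `ℤ^k` on the symbols `v(n)` by state shift. -/
instance : MulAction (Multiplicative (Fin k → ℤ)) (Λ.Obj × (Fin k → ℤ)) where
  smul m p := (p.1, p.2 + m.toAdd)
  one_smul p := Prod.ext rfl (add_zero p.2)
  mul_smul m n p := Prod.ext rfl (by
    change p.2 + (m.toAdd + n.toAdd) = p.2 + n.toAdd + m.toAdd
    abel)

theorem talentedRel_smul (m : Multiplicative (Fin k → ℤ)) (a b : Λ.Obj × (Fin k → ℤ) →₀ ℕ)
    (h : Λ.TalentedRel a b) :
    Λ.TalentedRel (Finsupp.mapDomain (m • ·) a) (Finsupp.mapDomain (m • ·) b) := by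
  cases h with
  | rel x n i S hS hne =>
    rw [Finsupp.mapDomain_finsetSum]
    simp only [Finsupp.mapDomain_single]
    have := TalentedRel.rel x (n + m.toAdd) i S hS hne
    rw [add_right_comm] at this
    exact this

/-- The talented monoid is a `ℤ^k`-monoid under state shift, where `m` maps `v(n)` to
`v(n + m)`. -/
noncomputable instance : DistribMulAction (Multiplicative (Fin k → ℤ)) Λ.TalentedMonoid :=
  Presented.distribMulAction Λ.TalentedRel Λ.talentedRel_smul

/-! ### The path groupoid -/

/-- Infinite paths: degree-preserving functors from the grid category `Ω_k` to `Λ`. The category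
`Ω_k` has object set `ℕ^k` and exactly one arrow `(m, n)` with range `m`, source `n` and degree
`n - m` whenever `m ≤ n`. -/
structure InfinitePath where
  /-- the vertex `x(m)` -/
  vert : (Fin k → ℕ) → Λ.Obj
  /-- the path `x(m, n)` -/
  seg : ∀ {m n : Fin k → ℕ}, m ≤ n → (vert n ⟶ vert m)
  seg_refl : ∀ m : Fin k → ℕ, seg (le_refl m) = 𝟙 (vert m)
  seg_trans : ∀ {m n p : Fin k → ℕ} (h : m ≤ n) (h' : n ≤ p),
    seg h' ≫ seg h = seg (h.trans h')
  degree_seg : ∀ {m n : Fin k → ℕ} (h : m ≤ n), m + Λ.degree (seg h) = n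

variable {Λ}

namespace InfinitePath

/-- The segment `x(m, n)` as a bundled path. -/
def path (x : Λ.InfinitePath) {m n : Fin k → ℕ} (h : m ≤ n) : Λ.Path := ⟨_, _, x.seg h⟩

theorem ext_path {x y : Λ.InfinitePath}
    (h : ∀ (m n : Fin k → ℕ) (hmn : m ≤ n), x.path hmn = y.path hmn) : x = y := by
  rcases x with ⟨vx, sx, _, _, _⟩
  rcases y with ⟨vy, sy, _, _, _⟩
  have hv : vx = vy := funext fun m => congrArg CatArrow.rng (h m m le_rfl)
  subst hv
  have hs : @sx = @sy := by
    funext m n hmn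
    have := h m n hmn
    simp only [path, CatArrow.mk.injEq, heq_eq_eq, true_and] at this
    exact this
  subst hs
  rfl

/-- The range `x(0)` of an infinite path. -/
def range (x : Λ.InfinitePath) : Λ.Obj := x.vert 0

/-- The shifted infinite path `σ^p(x)`. -/
def shift (p : Fin k → ℕ) (x : Λ.InfinitePath) : Λ.InfinitePath where
  vert m := x.vert (m + p)
  seg h := x.seg (add_le_add_left h p)
  seg_refl m := x.seg_refl (m + p)
  seg_trans h h' := x.seg_trans _ _
  degree_seg {m n} h := by
    have := x.degree_seg (add_le_add_left h p)
    rw [add_right_comm] at this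
    exact add_right_cancel this

theorem path_congr (x : Λ.InfinitePath) {m n m' n' : Fin k → ℕ} (h : m ≤ n) (h' : m' ≤ n')
    (hm : m = m') (hn : n = n') : x.path h = x.path h' := by
  subst hm hn
  rfl

theorem shift_shift (p q : Fin k → ℕ) (x : Λ.InfinitePath) :
    shift p (shift q x) = shift (p + q) x :=
  ext_path fun m n _ => x.path_congr _ _ (add_assoc m p q) (add_assoc n p q)

theorem shift_zero (x : Λ.InfinitePath) : shift 0 x = x :=
  ext_path fun m n _ => x.path_congr _ _ (add_zero m) (add_zero n)

end InfinitePath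

/-- The inclusion of `ℕ^k` into `ℤ^k`. -/
def toInt (n : Fin k → ℕ) : Fin k → ℤ := fun i => (n i : ℤ)

theorem toInt_add (m n : Fin k → ℕ) : toInt (m + n) = toInt m + toInt n := by
  funext i
  simp [toInt]

open InfinitePath in
/-- The path groupoid: the arrows with range `x` and source `y` are the triples `(x, p - q, y)` with
`p, q ∈ ℕ^k` and `σ^p(x) = σ^q(y)`. -/
instance : Groupoid Λ.InfinitePath where
  Hom y x := {n : Fin k → ℤ // ∃ p q : Fin k → ℕ, n = toInt p - toInt q ∧ shift p x = shift q y}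
  id x := ⟨0, 0, 0, (sub_self _).symm, rfl⟩
  comp {z y x} f g := ⟨g.1 + f.1, by
    obtain ⟨n, p, q, rfl, hf⟩ := f
    obtain ⟨m, p', q', rfl, hg⟩ := g
    refine ⟨p + p', q' + q, ?_, ?_⟩
    · simp only [toInt_add]
      abel
    · rw [← shift_shift, hg, shift_shift, add_comm, ← shift_shift, hf, shift_shift]⟩
  id_comp f := Subtype.ext (add_zero f.1)
  comp_id f := Subtype.ext (zero_add f.1)
  assoc f g h := Subtype.ext (add_assoc h.1 g.1 f.1).symm
  inv f := ⟨-f.1, by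
    obtain ⟨n, p, q, rfl, hf⟩ := f
    exact ⟨q, p, neg_sub _ _, hf.symm⟩⟩
  inv_comp f := Subtype.ext (add_neg_cancel f.1)
  comp_inv f := Subtype.ext (neg_add_cancel f.1)

/-- The canonical cocycle `(x, n, y) ↦ n` on the path groupoid. -/
def canonicalCocycle (Λ : KGraph.{u} k) : Cocycle Λ.InfinitePath (Fin k → ℤ) where
  toFun f := f.1
  map_comp _ _ := rfl

/-- The relation `x = λz`: the infinite path `x` has initial segment `λ`, followed by `z`. -/
def IsConcat (lam : Λ.Path) (z x : Λ.InfinitePath) : Prop :=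
  x.path (m := 0) (n := Λ.deg lam) (fun _ => Nat.zero_le _) = lam ∧ x.shift (Λ.deg lam) = z

/-- The set `Z(λ, μ)` of all arrows `(λz, d(λ) - d(μ), μz)`, where `z` runs through the infinite
paths with range `s(λ)`. -/
def cylinder (lam mu : Λ.Path) : Set (CatArrow Λ.InfinitePath) :=
  {g | ∃ z : Λ.InfinitePath, z.range = lam.src ∧ IsConcat lam z g.rng ∧ IsConcat mu z g.src ∧
    (canonicalCocycle Λ).toFun g.hom = toInt (Λ.deg lam) - toInt (Λ.deg mu)}

/-- The topology of the path groupoid, generated by the sets `Z(λ, μ)` with `s(λ) = s(μ)`. -/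
instance : TopologicalSpace (CatArrow Λ.InfinitePath) :=
  TopologicalSpace.generateFrom
    {S | ∃ lam mu : Λ.Path, lam.src = mu.src ∧ S = cylinder lam mu}

/-- The set `Z(v) = Z(v, v)`, that is, `vΛ^∞` regarded as a set of units. -/
def vertexCylinder (x : Λ.Obj) : Set (CatArrow Λ.InfinitePath) :=
  cylinder (Λ.vertexPath x) (Λ.vertexPath x)

end KGraph

end HRG

namespace HRG

namespace KGraph

variable {k : ℕ} {Λ : KGraph.{u} k}

/-! ### Composition of bundled paths -/

/-! Both monoids are compared with free commutative monoids at a common level N in ℤ^k. Iterating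
the relations rewrites v(n), for n ≤ N, as the sum of s(α)(N) over α in vΛ^{N-n} (`gen_eq_sum`). So
for all large N an element of T_Λ comes from a vector in the free commutative monoid on Λ⁰, and two
representatives of one element have the same vector once N is large (`eventually_push_eq`).
Recording these vectors as germs at infinity embeds T_Λ (`talentedGerm_injective`). An equation in
T_Λ thus becomes an equation in a free commutative monoid at one large level, where conicality and
refinement are evident.

On the groupoid side the same role is played by the boxes `skewBox N λ μ`, that is Z(λ, μ) × {N -
d(λ)}. Boxes of one level are equal or disjoint, a box of higher level meeting a box of lower level
lies inside it (`skewBox_subset`), and for s(λ) = s(μ) they are compact and open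
(`isCompact_skewBox`). Hence a compact open set is a finite disjoint union of boxes of level N for
every large N (`eventually_exists_skewBox`).

The type of a diagonal box depends only on N and s(λ) (`typ_boxIdem`), and cutting Z(v) × {n} along
initial segments reproduces the relations of T_Λ. This gives the homomorphism `talentedToTyp` and
its surjectivity. For injectivity, counting the sources of the boxes in a compact open set of units
defines `typGerm` into the same germs. It respects W⁻¹W ~ WW⁻¹ because each box Z(λ, μ) inside W has
s(λ) = s(μ). Since `typGerm` after `talentedToTyp` is the injective map `talentedGerm`, the first
map is injective. -/

/-- The relation `γ = αβ` between bundled paths. -/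
def IsComp (α β γ : Λ.Path) : Prop :=
  ∃ (x y z : Λ.Obj) (a : y ⟶ z) (b : x ⟶ y),
    α = ⟨y, z, a⟩ ∧ β = ⟨x, y, b⟩ ∧ γ = ⟨x, z, b ≫ a⟩

/-- The path `α` is an initial segment of `γ`. -/
def IsInitial (α γ : Λ.Path) : Prop := ∃ β, IsComp α β γ

theorem IsComp.deg {α β γ : Λ.Path} (h : IsComp α β γ) : Λ.deg γ = Λ.deg α + Λ.deg β := by
  obtain ⟨x, y, z, a, b, rfl, rfl, rfl⟩ := h
  exact Λ.degree_comp b a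

theorem IsComp.rng_eq {α β γ : Λ.Path} (h : IsComp α β γ) : γ.rng = α.rng := by
  obtain ⟨x, y, z, a, b, rfl, rfl, rfl⟩ := h
  rfl

theorem IsComp.src_eq {α β γ : Λ.Path} (h : IsComp α β γ) : γ.src = β.src := by
  obtain ⟨x, y, z, a, b, rfl, rfl, rfl⟩ := h
  rfl

theorem IsComp.rng_eq_src {α β γ : Λ.Path} (h : IsComp α β γ) : β.rng = α.src := by
  obtain ⟨x, y, z, a, b, rfl, rfl, rfl⟩ := h
  rfl

theorem exists_isComp {α β : Λ.Path} (h : β.rng = α.src) : ∃ γ, IsComp α β γ := by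
  obtain ⟨y, z, a⟩ := α
  obtain ⟨x, y', b⟩ := β
  obtain rfl : y' = y := h
  exact ⟨_, x, _, z, a, b, rfl, rfl, rfl⟩

theorem IsComp.unique {α β γ γ' : Λ.Path} (h : IsComp α β γ) (h' : IsComp α β γ') : γ = γ' := by
  obtain ⟨x, y, z, a, b, rfl, rfl, rfl⟩ := h
  obtain ⟨x', y', z', a', b', h1, h2, rfl⟩ := h'
  cases h1
  cases h2
  rfl

/-- Cancellation in ℕ^k makes the degrees of the second factors agree too, so unique factorization
applies. All later uniqueness arguments for paths rest on this. -/
theorem IsComp.eq_and_eq {α β α' β' γ : Λ.Path} (h : IsComp α β γ) (h' : IsComp α' β' γ)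
    (hd : Λ.deg α = Λ.deg α') : α = α' ∧ β = β' := by
  have hβ : Λ.deg β = Λ.deg β' := by
    have := h.deg.symm.trans h'.deg
    rw [hd] at this
    exact add_left_cancel this
  obtain ⟨x, y, z, a, b, rfl, rfl, rfl⟩ := h
  obtain ⟨x', y', z', a', b', rfl, rfl, h3⟩ := h'
  obtain ⟨rfl, rfl, h3⟩ := (CatArrow.mk.injEq ..).mp h3
  have h3 := eq_of_heq h3
  obtain ⟨p, -, hp⟩ := Λ.factorization (b ≫ a) _ _ (Λ.degree_comp b a)
  have h1 := hp ⟨y, a, b⟩ ⟨rfl, rfl, rfl⟩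
  have h2 := hp ⟨y', a', b'⟩ ⟨h3.symm, hd.symm, hβ.symm⟩
  have h4 := h1.trans h2.symm
  cases h4
  exact ⟨rfl, rfl⟩

theorem IsComp.unique_right {α β β' γ : Λ.Path} (h : IsComp α β γ) (h' : IsComp α β' γ) :
    β = β' := (h.eq_and_eq h' rfl).2

theorem exists_isComp_of_deg {γ : Λ.Path} {m n : Fin k → ℕ} (h : Λ.deg γ = m + n) :
    ∃ α β, IsComp α β γ ∧ Λ.deg α = m ∧ Λ.deg β = n := by
  obtain ⟨x, y, f⟩ := γ
  obtain ⟨⟨z, a, b⟩, ⟨h1, h2, h3⟩, -⟩ := Λ.factorization f m n h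
  exact ⟨⟨z, y, a⟩, ⟨x, z, b⟩, ⟨x, z, y, a, b, rfl, rfl, by rw [h1]⟩, h2, h3⟩

theorem IsComp.assoc {α β γ δ ε : Λ.Path} (h : IsComp α β γ) (h' : IsComp γ δ ε) :
    ∃ η, IsComp β δ η ∧ IsComp α η ε := by
  obtain ⟨x, y, z, a, b, rfl, rfl, rfl⟩ := h
  obtain ⟨x', y', z', a', b', h1, rfl, rfl⟩ := h'
  cases h1
  exact ⟨_, ⟨_, _, _, b, b', rfl, rfl, rfl⟩, ⟨_, _, _, a, b' ≫ b, rfl, rfl, by simp⟩⟩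

theorem IsComp.assoc' {α β δ ε η : Λ.Path} (h : IsComp β δ η) (h' : IsComp α η ε) :
    ∃ γ, IsComp α β γ ∧ IsComp γ δ ε := by
  obtain ⟨x, y, z, a, b, rfl, rfl, rfl⟩ := h
  obtain ⟨x', y', z', a', b', rfl, h1, rfl⟩ := h'
  cases h1
  exact ⟨_, ⟨_, _, _, a', a, rfl, rfl, rfl⟩, ⟨_, _, _, a ≫ a', b, rfl, rfl, by simp⟩⟩

@[simp]
theorem deg_vertexPath (x : Λ.Obj) : Λ.deg (Λ.vertexPath x) = 0 := Λ.degree_id x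

theorem isComp_vertexPath_left (α : Λ.Path) : IsComp (Λ.vertexPath α.rng) α α :=
  ⟨_, _, _, 𝟙 _, α.hom, rfl, rfl, by simp⟩

theorem isComp_vertexPath_right (α : Λ.Path) : IsComp α (Λ.vertexPath α.src) α :=
  ⟨_, _, _, α.hom, 𝟙 _, rfl, rfl, by simp⟩

theorem eq_vertexPath_of_deg {α : Λ.Path} (h : Λ.deg α = 0) : α = Λ.vertexPath α.rng :=
  ((isComp_vertexPath_right α).eq_and_eq (isComp_vertexPath_left α) (by simp [h])).1

theorem IsComp.eq_of_deg_left {α β γ : Λ.Path} (h : IsComp α β γ) (hd : Λ.deg α = 0) : β = γ :=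
  (h.eq_and_eq (isComp_vertexPath_left γ) (by simp [hd])).2

theorem IsInitial.refl (α : Λ.Path) : IsInitial α α := ⟨_, isComp_vertexPath_right α⟩

theorem IsInitial.trans {α β γ : Λ.Path} (h : IsInitial α β) (h' : IsInitial β γ) :
    IsInitial α γ := by
  obtain ⟨_, h⟩ := h
  obtain ⟨_, h'⟩ := h'
  obtain ⟨η, -, h⟩ := h.assoc h'
  exact ⟨η, h⟩

theorem exists_isInitial {γ : Λ.Path} {m : Fin k → ℕ} (h : m ≤ Λ.deg γ) :
    ∃ α, IsInitial α γ ∧ Λ.deg α = m := by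
  obtain ⟨α, β, h, h', -⟩ := exists_isComp_of_deg (add_tsub_cancel_of_le h).symm
  exact ⟨α, ⟨β, h⟩, h'⟩

theorem IsInitial.eq_of_deg {α α' γ : Λ.Path} (h : IsInitial α γ) (h' : IsInitial α' γ)
    (hd : Λ.deg α = Λ.deg α') : α = α' := by
  obtain ⟨_, h⟩ := h
  obtain ⟨_, h'⟩ := h'
  exact (h.eq_and_eq h' hd).1

theorem IsInitial.of_deg_le {α α' γ : Λ.Path} (h : IsInitial α γ) (h' : IsInitial α' γ)
    (hd : Λ.deg α ≤ Λ.deg α') : IsInitial α α' := by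
  obtain ⟨δ, hδ, hd'⟩ := exists_isInitial hd
  rwa [h.eq_of_deg (hδ.trans h') hd'.symm]

theorem IsInitial.rng_eq {α γ : Λ.Path} (h : IsInitial α γ) : γ.rng = α.rng := by
  obtain ⟨_, h⟩ := h
  exact h.rng_eq

/-! ### Infinite paths and their initial segments -/

namespace InfinitePath

/-- The initial segment `x(0, m)`. -/
def pre (x : Λ.InfinitePath) (m : Fin k → ℕ) : Λ.Path :=
  x.path (m := 0) (n := m) (fun _ => Nat.zero_le _)

theorem isComp_path (x : Λ.InfinitePath) {m n p : Fin k → ℕ} (h : m ≤ n) (h' : n ≤ p) :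
    IsComp (x.path h) (x.path h') (x.path (h.trans h')) :=
  ⟨_, _, _, x.seg h, x.seg h', rfl, rfl, by rw [x.seg_trans]; rfl⟩

@[simp]
theorem deg_pre (x : Λ.InfinitePath) (m : Fin k → ℕ) : Λ.deg (x.pre m) = m := by
  have := x.degree_seg (m := 0) (n := m) (fun _ => Nat.zero_le _)
  rwa [zero_add] at this

@[simp]
theorem pre_rng (x : Λ.InfinitePath) (m : Fin k → ℕ) : (x.pre m).rng = x.range := rfl

theorem range_shift (x : Λ.InfinitePath) (p : Fin k → ℕ) : (x.shift p).range = (x.pre p).src :=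
  congrArg x.vert (zero_add p)

theorem isComp_pre_shift (x : Λ.InfinitePath) (p m : Fin k → ℕ) :
    IsComp (x.pre p) ((x.shift p).pre m) (x.pre (p + m)) := by
  have h := x.isComp_path (m := 0) (n := p) (p := p + m) (fun _ => Nat.zero_le _) (by simp)
  have h' : (x.shift p).pre m = x.path (m := p) (n := p + m) (by simp) :=
    x.path_congr _ _ (zero_add p) (add_comm m p)
  rwa [h']

theorem isInitial_pre (x : Λ.InfinitePath) {m n : Fin k → ℕ} (h : m ≤ n) :
    IsInitial (x.pre m) (x.pre n) := ⟨_, x.isComp_path _ h⟩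

theorem pre_eq_of_le {x y : Λ.InfinitePath} {m n : Fin k → ℕ} (hmn : m ≤ n)
    (h : x.pre n = y.pre n) : x.pre m = y.pre m :=
  (x.isInitial_pre hmn).eq_of_deg (h ▸ y.isInitial_pre hmn) (by simp)

/-- The segment x(m, n) is the second factor of x(0, n) after x(0, m), hence determined by it. -/
theorem ext_pre {x y : Λ.InfinitePath} (h : ∀ m, x.pre m = y.pre m) : x = y := by
  refine ext_path fun m n hmn => ?_
  have h1 := x.isComp_path (m := 0) (fun _ => Nat.zero_le _) hmn
  have h2 := y.isComp_path (m := 0) (fun _ => Nat.zero_le _) hmn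
  rw [show y.path _ = x.path _ from (h n).symm] at h2
  exact (h1.eq_and_eq h2 ((x.deg_pre m).trans (y.deg_pre m).symm)).2

theorem eq_of_pre_eq_of_shift_eq {x y : Λ.InfinitePath} {p : Fin k → ℕ}
    (h : x.pre p = y.pre p) (h' : x.shift p = y.shift p) : x = y := by
  refine ext_pre fun m => pre_eq_of_le (n := p + m) (by simp) ?_
  exact (x.isComp_pre_shift p m).unique (h ▸ h' ▸ y.isComp_pre_shift p m)

/-- A compatible family of paths of all degrees defines an infinite path. -/
theorem exists_of_compatible (f : (Fin k → ℕ) → Λ.Path) (hd : ∀ m, Λ.deg (f m) = m)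
    (hf : ∀ m n, m ≤ n → IsInitial (f m) (f n)) :
    ∃ x : Λ.InfinitePath, ∀ m, x.pre m = f m := by
  have h : ∀ {m n} (_ : m ≤ n), ∃ b : (f n).src ⟶ (f m).src,
      IsComp (f m) ⟨_, _, b⟩ (f n) := by
    intro m n hmn
    obtain ⟨⟨s, r, b⟩, hb⟩ := hf m n hmn
    obtain rfl : r = _ := hb.rng_eq_src
    obtain rfl := hb.src_eq
    exact ⟨b, hb⟩
  choose b hb using @h
  -- The segment x(m, n) is the complementary factor of f(m) in f(n); functoriality follows from
  -- uniqueness of that factor.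
  refine ⟨⟨fun m => (f m).src, fun h => b h, fun m => ?_, fun {m n p} h h' => ?_,
    fun {m n} h => ?_⟩, fun m => ?_⟩
  · have := (hb (le_refl m)).unique_right (isComp_vertexPath_right (f m))
    exact eq_of_heq ((CatArrow.mk.injEq ..).mp this).2.2
  · obtain ⟨η, h1, h2⟩ := (hb h).assoc (hb h')
    have h3 := h1.unique ⟨_, _, _, b h, b h', rfl, rfl, rfl⟩
    subst h3
    exact eq_of_heq ((CatArrow.mk.injEq ..).mp (h2.unique_right (hb (h.trans h')))).2.2
  · have := (hb h).deg
    rw [hd, hd] at this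
    exact this.symm
  · have h0 : (0 : Fin k → ℕ) ≤ m := fun _ => Nat.zero_le _
    have h1 := hb h0
    exact (hb h0).eq_of_deg_left (hd 0)

/-- A monotone family of paths of arbitrarily large degrees defines an infinite path. -/
theorem exists_of_cofinal (g : (Fin k → ℕ) → Λ.Path) (hd : ∀ m, m ≤ Λ.deg (g m))
    (hg : ∀ m n, m ≤ n → IsInitial (g m) (g n)) :
    ∃ x : Λ.InfinitePath, ∀ m, x.pre (Λ.deg (g m)) = g m := by
  choose f hf hfd using fun m => exists_isInitial (hd m)
  obtain ⟨x, hx⟩ := exists_of_compatible f hfd fun m n hmn =>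
    ((hf m).trans (hg m n hmn)).of_deg_le (hf n) (by rwa [hfd, hfd])
  refine ⟨x, fun m => ?_⟩
  rw [hx]
  exact (hf _).eq_of_deg (hg m _ (hd m)) (hfd _)

/-- The infinite path `λz` exists if `r(z) = s(λ)`. -/
theorem exists_concat {lam : Λ.Path} {z : Λ.InfinitePath} (h : z.range = lam.src) :
    ∃ x : Λ.InfinitePath, x.pre (Λ.deg lam) = lam ∧ x.shift (Λ.deg lam) = z := by
  -- The paths λz(0, m) form a monotone family of degrees d(λ) + m, which is cofinal.
  choose g hg using fun m => exists_isComp (α := lam) (β := z.pre m) h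
  obtain ⟨x, hx⟩ := exists_of_cofinal g (fun m => by rw [(hg m).deg]; simp) fun m n hmn => by
    obtain ⟨δ, hδ⟩ := z.isInitial_pre hmn
    obtain ⟨γ, h1, h2⟩ := hδ.assoc' (hg n)
    exact ⟨δ, (h1.unique (hg m)) ▸ h2⟩
  have hx' : ∀ m, x.pre (Λ.deg lam + m) = g m := fun m => by
    have := hx m
    rwa [(hg m).deg, deg_pre] at this
  have key : ∀ m, x.pre (Λ.deg lam) = lam ∧ (x.shift (Λ.deg lam)).pre m = z.pre m := fun m =>
    (x.isComp_pre_shift _ m).eq_and_eq ((hx' m).symm ▸ hg m) (by simp)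
  exact ⟨x, (key 0).1, ext_pre fun m => (key m).2⟩

/-- If there are no sources, then each vertex is the range of an infinite path. -/
theorem exists_range_eq (hns : Λ.NoSources) (v : Λ.Obj) : ∃ x : Λ.InfinitePath, x.range = v := by
  -- Here 1 is the vector (1, …, 1): extending along the diagonal makes all coordinates of the
  -- degree grow at once.
  have step : ∀ α : Λ.Path, ∃ γ, IsInitial α γ ∧ Λ.deg γ = Λ.deg α + 1 := fun α => by
    obtain ⟨β, hβ, hd⟩ := hns α.src 1
    obtain ⟨γ, h⟩ := exists_isComp hβ
    exact ⟨γ, ⟨β, h⟩, by rw [h.deg, hd]⟩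
  choose e he hd using step
  let g : ℕ → Λ.Path := fun j => e^[j] (Λ.vertexPath v)
  have hg : ∀ j, g (j + 1) = e (g j) := fun j => Function.iterate_succ_apply' _ _ _
  have hgd : ∀ j, Λ.deg (g j) = fun _ => j := by
    intro j
    induction j with
    | zero => exact deg_vertexPath v
    | succ j ih => rw [hg, hd, ih]; rfl
  have hgm : ∀ i j, i ≤ j → IsInitial (g i) (g j) := by
    intro i j hij
    induction j, hij using Nat.le_induction with
    | base => exact .refl _
    | succ j _ ih => exact ih.trans (hg j ▸ he _)
  -- The sum of the coordinates is monotone in m and bounds every coordinate, so this path has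
  -- degree at least m.
  obtain ⟨x, hx⟩ := exists_of_cofinal (fun m => g (∑ i, m i))
    (fun m => by
      rw [hgd]
      exact fun i => Finset.single_le_sum (fun _ _ => Nat.zero_le _) (Finset.mem_univ i))
    (fun m n hmn => hgm _ _ (Finset.sum_le_sum fun i _ => hmn i))
  refine ⟨x, ?_⟩
  have := congrArg CatArrow.rng (hx 0)
  simp only [Pi.zero_apply, Finset.sum_const_zero] at this
  exact this

end InfinitePath

end KGraph

/-! ### Homomorphisms out of presented monoids -/

section Lift

variable {G : Type u} {M : Type v} [AddCommMonoid M]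

/-- The additive extension of a map to the free commutative monoid. -/
noncomputable def freeLift (f : G → M) : (G →₀ ℕ) →+ M :=
  (Finsupp.linearCombination ℕ f).toAddMonoidHom

@[simp]
theorem freeLift_single (f : G → M) (g : G) : freeLift f (Finsupp.single g 1) = f g := by
  simp [freeLift]

theorem freeLift_hom_ext {f g : (G →₀ ℕ) →+ M}
    (h : ∀ x, f (Finsupp.single x 1) = g (Finsupp.single x 1)) : f = g :=
  Finsupp.addHom_ext' fun x => AddMonoidHom.ext_nat (h x)

/-- The homomorphism out of a presented monoid given by images of the generators. -/
noncomputable def Presented.lift (R : (G →₀ ℕ) → (G →₀ ℕ) → Prop) (f : G → M)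
    (h : ∀ x y, R x y → freeLift f x = freeLift f y) : Presented R →+ M :=
  (addConGen R).lift (freeLift f) (AddCon.addConGen_le.2 h)

theorem Presented.lift_mk (R : (G →₀ ℕ) → (G →₀ ℕ) → Prop) (f : G → M)
    (h : ∀ x y, R x y → freeLift f x = freeLift f y) (x : G →₀ ℕ) :
    Presented.lift R f h (Presented.mk R x) = freeLift f x := rfl

@[simp]
theorem Presented.lift_of (R : (G →₀ ℕ) → (G →₀ ℕ) → Prop) (f : G → M)
    (h : ∀ x y, R x y → freeLift f x = freeLift f y) (g : G) :
    Presented.lift R f h (Presented.of R g) = f g := freeLift_single f g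

theorem Presented.mk_eq_freeLift (R : (G →₀ ℕ) → (G →₀ ℕ) → Prop) :
    Presented.mk R = freeLift (Presented.of R) :=
  freeLift_hom_ext fun x => by rw [freeLift_single]; rfl

theorem Presented.hom_ext {R : (G →₀ ℕ) → (G →₀ ℕ) → Prop} {f g : Presented R →+ M}
    (h : ∀ x, f (Presented.of R x) = g (Presented.of R x)) : f = g := by
  have : f.comp (Presented.mk R) = g.comp (Presented.mk R) := freeLift_hom_ext h
  ext a
  obtain ⟨x, rfl⟩ := Presented.mk_surjective R a
  exact DFunLike.congr_fun this x

theorem Presented.mk_eq_of_rel {R : (G →₀ ℕ) → (G →₀ ℕ) → Prop} {x y : G →₀ ℕ} (h : R x y) :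
    Presented.mk R x = Presented.mk R y := (AddCon.eq _).2 (AddConGen.Rel.of _ _ h)

end Lift

/-- Free commutative monoids have the refinement property. -/
theorem isRefinement_finsupp (G : Type u) : IsRefinement (G →₀ ℕ) := by
  intro a b c d h
  have h' : ∀ g, a g + b g = c g + d g := fun g => DFunLike.congr_fun h g
  -- The pointwise minimum of a and c is the corner entry; the other three entries are then forced.
  refine ⟨a ⊓ c, a - a ⊓ c, c - a ⊓ c, b - (c - a ⊓ c), ?_, ?_, ?_, ?_⟩ <;> ext g <;>
    have := h' g <;>
    simp only [Finsupp.add_apply, Finsupp.tsub_apply, Finsupp.inf_apply] <;> omega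

namespace KGraph

variable {k : ℕ} {Λ : KGraph.{u} k}

/-! ### Sums over the sets `vΛⁿ` -/

/-- The finite set `vΛⁿ`. -/
noncomputable def pathFinset (hrf : Λ.RowFinite) (v : Λ.Obj) (n : Fin k → ℕ) : Finset Λ.Path :=
  (hrf v n).toFinset

theorem mem_pathFinset {hrf : Λ.RowFinite} {v : Λ.Obj} {n : Fin k → ℕ} {α : Λ.Path} :
    α ∈ pathFinset hrf v n ↔ α.rng = v ∧ Λ.deg α = n := Set.Finite.mem_toFinset _

theorem pathFinset_zero (hrf : Λ.RowFinite) (v : Λ.Obj) :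
    pathFinset hrf v 0 = {Λ.vertexPath v} := by
  ext α
  rw [mem_pathFinset, Finset.mem_singleton]
  constructor
  · rintro ⟨rfl, h⟩
    exact eq_vertexPath_of_deg h
  · rintro rfl
    exact ⟨rfl, deg_vertexPath v⟩

/-- Unique factorization is a bijection between paths of degree m + p and composable pairs of
degrees m and p. -/
theorem sum_pathFinset_add (hrf : Λ.RowFinite) {M : Type w} [AddCommMonoid M] (g : Λ.Obj → M)
    (v : Λ.Obj) (m p : Fin k → ℕ) :
    ∑ γ ∈ pathFinset hrf v (m + p), g γ.src
      = ∑ α ∈ pathFinset hrf v m, ∑ β ∈ pathFinset hrf α.src p, g β.src := by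
  rw [Finset.sum_sigma']
  have h : ∀ γ : Λ.Path, γ ∈ pathFinset hrf v (m + p) → ∃ q : (_ : Λ.Path) × Λ.Path,
      IsComp q.1 q.2 γ ∧ Λ.deg q.1 = m ∧ Λ.deg q.2 = p := fun γ hγ => by
    obtain ⟨α, β, h⟩ := exists_isComp_of_deg (mem_pathFinset.1 hγ).2
    exact ⟨⟨α, β⟩, h⟩
  choose q hq hm hp using h
  refine Finset.sum_bij q (fun γ hγ => ?_) (fun γ hγ γ' hγ' h => ?_) (fun s hs => ?_)
    (fun γ hγ => ?_)
  · simp only [Finset.mem_sigma, mem_pathFinset]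
    exact ⟨⟨(hq γ hγ).rng_eq.symm.trans (mem_pathFinset.1 hγ).1, hm γ hγ⟩,
      (hq γ hγ).rng_eq_src, hp γ hγ⟩
  · exact (hq γ hγ).unique (h ▸ hq γ' hγ')
  · obtain ⟨α, β⟩ := s
    simp only [Finset.mem_sigma, mem_pathFinset] at hs
    obtain ⟨⟨h1, h2⟩, h3, h4⟩ := hs
    obtain ⟨γ, hγ⟩ := exists_isComp h3
    have hmem : γ ∈ pathFinset hrf v (m + p) :=
      mem_pathFinset.2 ⟨hγ.rng_eq.trans h1, by rw [hγ.deg, h2, h4]⟩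
    refine ⟨γ, hmem, ?_⟩
    obtain ⟨h5, h6⟩ := (hq γ hmem).eq_and_eq hγ ((hm γ hmem).trans h2.symm)
    exact Sigma.ext h5 (heq_of_eq h6)
  · rw [(hq γ hγ).src_eq]

/-! ### Moving all generators of the talented monoid to a common level -/

theorem gen_eq_sum_single (hrf : Λ.RowFinite) (hns : Λ.NoSources) (v : Λ.Obj) (n : Fin k → ℤ)
    (i : Fin k) : Λ.gen v n
      = ∑ α ∈ pathFinset hrf v (Pi.single i 1), Λ.gen α.src (n + Pi.single i 1) := by
  have h := Presented.mk_eq_of_rel (TalentedRel.rel v n i (pathFinset hrf v (Pi.single i 1))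
    (Set.Finite.coe_toFinset _) ((Set.Finite.toFinset_nonempty _).2 (hns _ _)))
  rw [map_sum] at h
  exact h

theorem toInt_single (i : Fin k) : toInt (Pi.single i 1) = Pi.single i 1 := by
  funext j
  by_cases h : j = i
  · subst h
    simp [toInt]
  · simp [toInt, h]

theorem toInt_zero : toInt (0 : Fin k → ℕ) = 0 := rfl

theorem gen_eq_sum (hrf : Λ.RowFinite) (hns : Λ.NoSources) (m : Fin k → ℕ) :
    ∀ (v : Λ.Obj) (n : Fin k → ℤ),
      Λ.gen v n = ∑ α ∈ pathFinset hrf v m, Λ.gen α.src (n + toInt m) := by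
  -- The degrees m for which the formula holds form a submonoid, and the defining relations put
  -- every e_i in it.
  let S : AddSubmonoid (Fin k → ℕ) :=
    { carrier := {m | ∀ (v : Λ.Obj) (n : Fin k → ℤ),
        Λ.gen v n = ∑ α ∈ pathFinset hrf v m, Λ.gen α.src (n + toInt m)}
      zero_mem' := fun v n => by
        rw [pathFinset_zero, Finset.sum_singleton, toInt_zero, add_zero]
        rfl
      add_mem' := fun {m p} hm hp v n => by
        rw [sum_pathFinset_add hrf (fun x => Λ.gen x (n + toInt (m + p))), hm v n]
        refine Finset.sum_congr rfl fun α _ => ?_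
        rw [hp, toInt_add, add_assoc] }
  have hS : ∀ i, Pi.single i 1 ∈ S := fun i v n => by
    rw [toInt_single]
    exact gen_eq_sum_single hrf hns v n i
  change m ∈ S
  rw [← Finset.univ_sum_single m]
  refine sum_mem fun i _ => ?_
  have : (Pi.single i (m i) : Fin k → ℕ) = m i • Pi.single i 1 := by
    rw [← Pi.single_smul', smul_eq_mul, mul_one]
  rw [this]
  exact nsmul_mem (hS i) _

/-- The difference `N - n`, truncated to `ℕ^k`. -/
def natDiff (N n : Fin k → ℤ) : Fin k → ℕ := fun i => (N i - n i).toNat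

theorem add_toInt_natDiff {N n : Fin k → ℤ} (h : n ≤ N) : n + toInt (natDiff N n) = N := by
  funext i
  have : n i ≤ N i := h i
  simp only [Pi.add_apply, toInt, natDiff]
  omega

theorem natDiff_eq {N n : Fin k → ℤ} {m : Fin k → ℕ} (h : n + toInt m = N) : natDiff N n = m := by
  subst h
  funext i
  simp [toInt, natDiff]

/-- The sources of all paths in `vΛ^{N - n}`, counted with multiplicity. -/
noncomputable def pushGen (hrf : Λ.RowFinite) (N : Fin k → ℤ) (p : Λ.Obj × (Fin k → ℤ)) :
    Λ.Obj →₀ ℕ :=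
  ∑ α ∈ pathFinset hrf p.1 (natDiff N p.2), Finsupp.single α.src 1

/-- The bound on N keeps the truncated difference honest. Below it `pushGen` has no meaning, which
is why only germs at infinity are used. -/
theorem pushGen_eq_sum (hrf : Λ.RowFinite) {N n : Fin k → ℤ} (v : Λ.Obj) (i : Fin k)
    (h : n + Pi.single i 1 ≤ N) : pushGen hrf N (v, n)
      = ∑ α ∈ pathFinset hrf v (Pi.single i 1), pushGen hrf N (α.src, n + Pi.single i 1) := by
  have h' : natDiff N n = Pi.single i 1 + natDiff N (n + Pi.single i 1) := natDiff_eq <| by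
    rw [toInt_add, toInt_single, ← add_assoc, add_toInt_natDiff h]
  simp only [pushGen, h']
  exact sum_pathFinset_add hrf (fun x => Finsupp.single x 1) v _ _

/-- Only finitely many levels occur in x, and any N above all of them works. -/
theorem sum_gen_eq (hrf : Λ.RowFinite) (hns : Λ.NoSources) (x : Λ.Obj × (Fin k → ℤ) →₀ ℕ) :
    ∀ᶠ N in Filter.atTop, Presented.mk Λ.TalentedRel x
      = freeLift (fun v => Λ.gen v N) (freeLift (pushGen hrf N) x) := by
  induction x using Finsupp.induction_linear with
  | zero => simp
  | add x y hx hy =>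
    filter_upwards [hx, hy] with N h1 h2
    simp only [map_add, h1, h2]
  | single p c =>
    filter_upwards [Filter.eventually_ge_atTop p.2] with N hN
    have : (Finsupp.single p c : Λ.Obj × (Fin k → ℤ) →₀ ℕ) = c • Finsupp.single p 1 := by simp
    rw [this]
    simp only [map_nsmul]
    congr 1
    rw [freeLift_single, pushGen, map_sum]
    simp only [freeLift_single]
    have := gen_eq_sum hrf hns (natDiff N p.2) p.1 p.2
    rw [add_toInt_natDiff hN] at this
    exact this

/-! ### Germs at infinity, conicality and refinement -/

/-- Germs at infinity of functions from `ℤ^k` to the free commutative monoid on the vertices. -/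
abbrev VertexGerm (Λ : KGraph.{u} k) : Type u :=
  Filter.Germ (Filter.atTop : Filter (Fin k → ℤ)) (Λ.Obj →₀ ℕ)

/-- The map from functions to germs as a homomorphism. -/
noncomputable def germHom (Λ : KGraph.{u} k) : ((Fin k → ℤ) → (Λ.Obj →₀ ℕ)) →+ VertexGerm Λ :=
  Filter.Germ.coeAddHom _

theorem germHom_eq {f g : (Fin k → ℤ) → (Λ.Obj →₀ ℕ)} :
    germHom Λ f = germHom Λ g ↔ ∀ᶠ N in Filter.atTop, f N = g N := Filter.Germ.coe_eq

theorem freeLift_germHom {G : Type v} (f : G → (Fin k → ℤ) → (Λ.Obj →₀ ℕ)) (x : G →₀ ℕ) :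
    freeLift (fun g => germHom Λ (f g)) x = germHom Λ (fun N => freeLift (fun g => f g N) x) := by
  have h : freeLift (fun g => germHom Λ (f g))
      = (germHom Λ).comp (AddMonoidHom.pi fun N => freeLift (fun g => f g N)) :=
    freeLift_hom_ext fun g => by
      rw [freeLift_single, AddMonoidHom.comp_apply]
      congr 1
      funext N
      simp
  rw [h]
  rfl

/-- The embedding of the talented monoid into the monoid of germs. -/
noncomputable def talentedGerm (hrf : Λ.RowFinite) : Λ.TalentedMonoid →+ VertexGerm Λ :=
  Presented.lift _ (fun p => germHom Λ (fun N => pushGen hrf N p)) <| by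
    rintro _ _ ⟨v, n, i, S, hS, -⟩
    obtain rfl : S = pathFinset hrf v (Pi.single i 1) := by
      ext α
      rw [← Finset.mem_coe, hS, mem_pathFinset]
      rfl
    rw [freeLift_germHom (fun p N => pushGen hrf N p), freeLift_germHom (fun p N => pushGen hrf N p),
      germHom_eq]
    filter_upwards [Filter.eventually_ge_atTop (n + Pi.single i 1)] with N hN
    rw [map_sum]
    simp only [freeLift_single]
    exact pushGen_eq_sum hrf v i hN

theorem talentedGerm_mk (hrf : Λ.RowFinite) (x : Λ.Obj × (Fin k → ℤ) →₀ ℕ) :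
    talentedGerm hrf (Presented.mk _ x) = germHom Λ (fun N => freeLift (pushGen hrf N) x) := by
  rw [talentedGerm, Presented.lift_mk, freeLift_germHom (fun p N => pushGen hrf N p)]

theorem talentedGerm_gen (hrf : Λ.RowFinite) (v : Λ.Obj) (n : Fin k → ℤ) :
    talentedGerm hrf (Λ.gen v n) = germHom Λ (fun N => pushGen hrf N (v, n)) :=
  Presented.lift_of _ _ _ _

/-- This turns an equality in the talented monoid into one in a free commutative monoid, valid at
all large levels. -/
theorem eventually_push_eq (hrf : Λ.RowFinite) {x y : Λ.Obj × (Fin k → ℤ) →₀ ℕ}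
    (h : Presented.mk Λ.TalentedRel x = Presented.mk Λ.TalentedRel y) :
    ∀ᶠ N in Filter.atTop, freeLift (pushGen hrf N) x = freeLift (pushGen hrf N) y := by
  have := congrArg (talentedGerm hrf) h
  rwa [talentedGerm_mk, talentedGerm_mk, germHom_eq] at this

theorem talentedGerm_injective (hrf : Λ.RowFinite) (hns : Λ.NoSources) :
    Function.Injective (talentedGerm hrf) := by
  intro a b h
  obtain ⟨x, rfl⟩ := Presented.mk_surjective _ a
  obtain ⟨y, rfl⟩ := Presented.mk_surjective _ b
  rw [talentedGerm_mk, talentedGerm_mk, germHom_eq] at h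
  obtain ⟨N, h, hx, hy⟩ := (h.and ((sum_gen_eq hrf hns x).and (sum_gen_eq hrf hns y))).exists
  rw [hx, hy, h]

theorem isConical_talentedMonoid (hrf : Λ.RowFinite) (hns : Λ.NoSources) :
    IsConical Λ.TalentedMonoid := by
  rintro a ⟨b, h⟩
  obtain ⟨x, rfl⟩ := Presented.mk_surjective _ a
  obtain ⟨y, rfl⟩ := Presented.mk_surjective _ b
  rw [← map_add, ← map_zero (Presented.mk _)] at h
  obtain ⟨N, h, hx⟩ := ((eventually_push_eq hrf h).and (sum_gen_eq hrf hns x)).exists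
  rw [map_add, map_zero] at h
  rw [hx, (add_eq_zero.1 h).1, map_zero]

/-- At one large level the equation holds between vectors of vertices. These are refined in the free
monoid and mapped back by v ↦ v(N). -/
theorem isRefinement_talentedMonoid (hrf : Λ.RowFinite) (hns : Λ.NoSources) :
    IsRefinement Λ.TalentedMonoid := by
  intro a b c d h
  obtain ⟨a, rfl⟩ := Presented.mk_surjective _ a
  obtain ⟨b, rfl⟩ := Presented.mk_surjective _ b
  obtain ⟨c, rfl⟩ := Presented.mk_surjective _ c
  obtain ⟨d, rfl⟩ := Presented.mk_surjective _ d
  rw [← map_add, ← map_add] at h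
  obtain ⟨N, h, ha, hb, hc, hd⟩ := ((eventually_push_eq hrf h).and ((sum_gen_eq hrf hns a).and
    ((sum_gen_eq hrf hns b).and ((sum_gen_eq hrf hns c).and (sum_gen_eq hrf hns d))))).exists
  rw [map_add, map_add] at h
  obtain ⟨z₁, z₂, z₃, z₄, h1, h2, h3, h4⟩ := isRefinement_finsupp _ _ _ _ _ h
  refine ⟨freeLift (fun v => Λ.gen v N) z₁, freeLift (fun v => Λ.gen v N) z₂,
    freeLift (fun v => Λ.gen v N) z₃, freeLift (fun v => Λ.gen v N) z₄, ?_, ?_, ?_, ?_⟩ <;>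
    rw [← map_add]
  · rw [ha, h1]
  · rw [hb, h2]
  · rw [hc, h3]
  · rw [hd, h4]

end KGraph

/-! ### Open sets of a skew product -/

theorem isOpen_atLevel {X : Type u} [Groupoid.{v} X] {Γ : Type w} [AddCommGroup Γ]
    [TopologicalSpace (CatArrow X)] (c : Cocycle X Γ) {U : Set (CatArrow X)} (hU : IsOpen U)
    (α : Γ) : IsOpen (atLevel c U α) := by
  let _ : TopologicalSpace Γ := ⊥
  have _ : DiscreteTopology Γ := ⟨rfl⟩
  exact isOpen_induced (hU.prod (isOpen_discrete {α}))

theorem exists_isOpen_atLevel_subset {X : Type u} [Groupoid.{v} X] {Γ : Type w} [AddCommGroup Γ]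
    [TopologicalSpace (CatArrow X)] (c : Cocycle X Γ) {S : Set (CatArrow (SkewProduct c))}
    (hS : IsOpen S) {a : CatArrow (SkewProduct c)} (ha : a ∈ S) :
    ∃ U : Set (CatArrow X), IsOpen U ∧ a ∈ atLevel c U a.rng.level ∧
      atLevel c U a.rng.level ⊆ S := by
  let _ : TopologicalSpace Γ := ⊥
  obtain ⟨T, hT, rfl⟩ := isOpen_induced_iff.1 hS
  obtain ⟨U, V, hU, -, haU, haV, hUV⟩ :=
    isOpen_prod_iff.1 hT (skewArrowEquiv c a).1 (skewArrowEquiv c a).2 ha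
  refine ⟨U, hU, ⟨haU, rfl⟩, ?_⟩
  rintro b ⟨hb, hb'⟩
  refine hUV ⟨hb, ?_⟩
  rw [hb']
  exact haV

namespace KGraph

variable {k : ℕ} {Λ : KGraph.{u} k}

theorem toInt_injective : Function.Injective (toInt : (Fin k → ℕ) → Fin k → ℤ) := fun _ _ h =>
  funext fun i => Int.ofNat.inj (congrFun h i)

theorem toInt_nonneg (m : Fin k → ℕ) : 0 ≤ toInt m := fun _ => Int.natCast_nonneg _

namespace InfinitePath

theorem pre_shift_congr {x y : Λ.InfinitePath} {p m : Fin k → ℕ}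
    (h : x.pre (p + m) = y.pre (p + m)) : (x.shift p).pre m = (y.shift p).pre m :=
  ((x.isComp_pre_shift p m).eq_and_eq (h ▸ y.isComp_pre_shift p m) (by simp)).2

theorem pre_add_congr {x y : Λ.InfinitePath} {p m : Fin k → ℕ} (h : x.pre p = y.pre p)
    (h' : (x.shift p).pre m = (y.shift p).pre m) : x.pre (p + m) = y.pre (p + m) :=
  (x.isComp_pre_shift p m).unique (h ▸ h' ▸ y.isComp_pre_shift p m)

end InfinitePath

open InfinitePath

variable (Λ) in
/-- The arrows of the skew product of the path groupoid by the canonical cocycle. -/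
abbrev SkewArrow := CatArrow (SkewProduct Λ.canonicalCocycle)

/-! ### Arrows of the skew product -/

/-- The skew product is principal: an arrow is determined by its source and its range. -/
theorem skewArrow_ext {a b : Λ.SkewArrow} (hs : a.src = b.src) (hr : a.rng = b.rng) : a = b := by
  obtain ⟨s, r, f⟩ := a
  obtain ⟨s', r', g⟩ := b
  obtain rfl : s = s' := hs
  obtain rfl : r = r' := hr
  have : f = g := Subtype.ext <| Subtype.ext <| by
    have h1 : s.level = r.level + f.1.1 := f.2
    have h2 : s.level = r.level + g.1.1 := g.2
    exact add_left_cancel (h1.symm.trans h2)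
  rw [this]

theorem exists_skewArrow {x y : Λ.InfinitePath} {α β : Fin k → ℤ} {p q : Fin k → ℕ}
    (h : x.shift p = y.shift q) (h' : α + toInt p = β + toInt q) :
    ∃ a : Λ.SkewArrow, a.rng = ⟨x, α⟩ ∧ a.src = ⟨y, β⟩ :=
  ⟨⟨⟨y, β⟩, ⟨x, α⟩, ⟨⟨toInt p - toInt q, p, q, rfl, h⟩, by
    change β = α + (toInt p - toInt q)
    rw [← add_sub_assoc, h', add_sub_cancel_right]⟩⟩, rfl, rfl⟩

theorem mem_units_iff {a : Λ.SkewArrow} :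
    a ∈ units (SkewProduct Λ.canonicalCocycle) ↔ a.src = a.rng := by
  constructor
  · rintro ⟨x, rfl⟩
    rfl
  · intro h
    exact ⟨a.src, skewArrow_ext rfl h.symm⟩

/-! ### Boxes of a given level -/

/-- The set of arrows `Z(λ, μ) × {N - d(λ)}` in the skew product. -/
def skewBox (N : Fin k → ℤ) (lam mu : Λ.Path) : Set Λ.SkewArrow :=
  {a | a.rng.base.pre (Λ.deg lam) = lam ∧ a.src.base.pre (Λ.deg mu) = mu ∧
    a.rng.base.shift (Λ.deg lam) = a.src.base.shift (Λ.deg mu) ∧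
    a.rng.level + toInt (Λ.deg lam) = N ∧ a.src.level + toInt (Λ.deg mu) = N}

/-- The level N of a box is the one reached from both ends after removing λ and μ. The cocycle
condition and the level of the source determine each other. -/
theorem skewBox_eq_atLevel (lam mu : Λ.Path) (α : Fin k → ℤ) :
    skewBox (α + toInt (Λ.deg lam)) lam mu
      = atLevel Λ.canonicalCocycle (cylinder lam mu) α := by
  ext a
  have h0 : a.src.level = a.rng.level + Λ.canonicalCocycle.toFun a.hom.1 := a.hom.2
  constructor
  · rintro ⟨h1, h2, h3, h4, h5⟩
    have h4' := add_right_cancel h4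
    refine ⟨⟨a.rng.base.shift (Λ.deg lam), ?_, ⟨h1, rfl⟩, ⟨h2, h3.symm⟩, ?_⟩, h4'⟩
    · rw [range_shift, h1]
    · change Λ.canonicalCocycle.toFun a.hom.1 = _
      rw [h0, add_assoc] at h5
      rw [eq_sub_iff_add_eq]
      exact add_left_cancel (h5.trans h4.symm)
  · rintro ⟨⟨z, -, ⟨h1, h2⟩, ⟨h3, h4⟩, h5⟩, h6⟩
    change a.rng.level = α at h6
    change Λ.canonicalCocycle.toFun a.hom.1 = _ at h5
    refine ⟨h1, h3, h2.trans h4.symm, by rw [h6], ?_⟩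
    rw [h0, h5, h6]
    abel

theorem isOpen_skewBox {lam mu : Λ.Path} (h : lam.src = mu.src) (N : Fin k → ℤ) :
    IsOpen (skewBox N lam mu) := by
  have hc : IsOpen (cylinder lam mu) := TopologicalSpace.GenerateOpen.basic _ ⟨lam, mu, h, rfl⟩
  rw [← sub_add_cancel N (toInt (Λ.deg lam)), skewBox_eq_atLevel]
  exact isOpen_atLevel _ hc _

theorem src_eq_of_mem_skewBox {N : Fin k → ℤ} {lam mu : Λ.Path} {a : Λ.SkewArrow}
    (h : a ∈ skewBox N lam mu) : lam.src = mu.src := by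
  obtain ⟨h1, h2, h3, -⟩ := h
  rw [← h1, ← h2, ← range_shift, ← range_shift]
  simpa using congrArg InfinitePath.range h3

theorem mem_skewBox_pre {x y : Λ.InfinitePath} {p q : Fin k → ℕ} {N : Fin k → ℤ}
    {a : Λ.SkewArrow} (hx : a.rng.base = x) (hy : a.src.base = y) (h : x.shift p = y.shift q)
    (hr : a.rng.level + toInt p = N) (hs : a.src.level + toInt q = N) :
    a ∈ skewBox N (x.pre p) (y.pre q) := by
  subst hx hy
  exact ⟨by simp, by simp, by simpa, by simpa, by simpa⟩

theorem exists_mem_skewBox {lam mu : Λ.Path} {x y : Λ.InfinitePath} (hx : x.pre (Λ.deg lam) = lam)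
    (hy : y.pre (Λ.deg mu) = mu) (h : x.shift (Λ.deg lam) = y.shift (Λ.deg mu))
    (N : Fin k → ℤ) : ∃ a ∈ skewBox N lam mu, a.rng = ⟨x, N - toInt (Λ.deg lam)⟩ ∧
      a.src = ⟨y, N - toInt (Λ.deg mu)⟩ := by
  obtain ⟨a, h1, h2⟩ := exists_skewArrow (α := N - toInt (Λ.deg lam))
    (β := N - toInt (Λ.deg mu)) h (by simp)
  exact ⟨a, ⟨by rw [h1, hx], by rw [h2, hy], by rw [h1, h2, h], by simp [h1], by simp [h2]⟩, h1, h2⟩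

theorem skewBox_nonempty (hns : Λ.NoSources) (N : Fin k → ℤ) {lam mu : Λ.Path}
    (h : lam.src = mu.src) : (skewBox N lam mu).Nonempty := by
  obtain ⟨z, hz⟩ := exists_range_eq hns lam.src
  obtain ⟨x, hx, hx'⟩ := exists_concat hz
  obtain ⟨y, hy, hy'⟩ := exists_concat (hz.trans h)
  obtain ⟨a, ha, -⟩ := exists_mem_skewBox hx hy (hx'.trans hy'.symm) N
  exact ⟨a, ha⟩

theorem deg_eq_of_level {α N N' : Fin k → ℤ} {p p' : Fin k → ℕ} (h : α + toInt p = N)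
    (h' : α + toInt p' = N') (hN : N ≤ N') : p' = p + natDiff N' N := by
  apply toInt_injective
  rw [toInt_add]
  have := add_toInt_natDiff hN
  rw [← h, ← h', add_assoc] at this
  rw [← h, ← h']
  exact (add_left_cancel this).symm

theorem deg_eq_of_level_eq {α N : Fin k → ℤ} {p p' : Fin k → ℕ} (h : α + toInt p = N)
    (h' : α + toInt p' = N) : p' = p :=
  toInt_injective (add_left_cancel (h'.trans h.symm))

/-- The level of the range and N determine d(λ), and then the range determines λ. Together with the
version for sources, this makes distinct boxes of level N disjoint. -/
theorem eq_of_mem_skewBox_of_rng_eq {N : Fin k → ℤ} {lam mu lam' mu' : Λ.Path}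
    {a b : Λ.SkewArrow} (h : a ∈ skewBox N lam mu) (h' : b ∈ skewBox N lam' mu')
    (hab : a.rng = b.rng) : lam = lam' := by
  obtain ⟨h1, -, -, h2, -⟩ := h
  obtain ⟨h1', -, -, h2', -⟩ := h'
  rw [hab] at h1 h2
  rw [← h1, ← h1', deg_eq_of_level_eq h2 h2']

theorem eq_of_mem_skewBox_of_src_eq {N : Fin k → ℤ} {lam mu lam' mu' : Λ.Path}
    {a b : Λ.SkewArrow} (h : a ∈ skewBox N lam mu) (h' : b ∈ skewBox N lam' mu')
    (hab : a.src = b.src) : mu = mu' := by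
  obtain ⟨-, h1, -, -, h2⟩ := h
  obtain ⟨-, h1', -, -, h2'⟩ := h'
  rw [hab] at h1 h2
  rw [← h1, ← h1', deg_eq_of_level_eq h2 h2']

/-- Both paths are prolonged by the first piece, of degree N' - N, of the common tail. -/
theorem exists_mem_skewBox_of_le {N N' : Fin k → ℤ} (hN : N ≤ N') {lam mu : Λ.Path}
    {a : Λ.SkewArrow} (h : a ∈ skewBox N lam mu) : ∃ lam' mu', a ∈ skewBox N' lam' mu' := by
  obtain ⟨-, -, h3, h4, h5⟩ := h
  refine ⟨_, _, mem_skewBox_pre (p := natDiff N' N + Λ.deg lam) (q := natDiff N' N + Λ.deg mu)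
    rfl rfl ?_ ?_ ?_⟩
  · rw [← shift_shift, h3, shift_shift]
  · rw [add_comm (natDiff N' N), toInt_add, ← add_assoc, h4, add_toInt_natDiff hN]
  · rw [add_comm (natDiff N' N), toInt_add, ← add_assoc, h5, add_toInt_natDiff hN]

/-- The common arrow forces λ' = λδ and μ' = μδ with the same δ of degree N' - N. -/
theorem skewBox_subset {N N' : Fin k → ℤ} (hN : N ≤ N') {lam mu lam' mu' : Λ.Path}
    {a : Λ.SkewArrow} (h : a ∈ skewBox N lam mu) (h' : a ∈ skewBox N' lam' mu') :
    skewBox N' lam' mu' ⊆ skewBox N lam mu := by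
  obtain ⟨h1, h2, h3, h4, h5⟩ := h
  obtain ⟨h1', h2', h3', h4', h5'⟩ := h'
  rintro b ⟨hb1, hb2, hb3, hb4, hb5⟩
  have hl := deg_eq_of_level h4 h4' hN
  have hm := deg_eq_of_level h5 h5' hN
  rw [hl] at h1' hb1 hb3 hb4
  rw [hm] at h2' hb2 hb3 hb5
  have h6 := hb1.trans h1'.symm
  have h7 := hb2.trans h2'.symm
  refine ⟨?_, ?_, ?_, ?_, ?_⟩
  · rw [pre_eq_of_le (by simp) h6, h1]
  · rw [pre_eq_of_le (by simp) h7, h2]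
  -- The two tails of b agree on the piece δ, by comparison with a, and beyond it, by membership in
  -- the smaller box.
  · refine eq_of_pre_eq_of_shift_eq (p := natDiff N' N) ?_ ?_
    · rw [pre_shift_congr h6, pre_shift_congr h7, h3]
    · rw [shift_shift, shift_shift, add_comm, hb3, add_comm]
  · rw [toInt_add, ← add_assoc] at hb4
    exact add_right_cancel (hb4.trans (add_toInt_natDiff hN).symm)
  · rw [toInt_add, ← add_assoc] at hb5
    exact add_right_cancel (hb5.trans (add_toInt_natDiff hN).symm)

/-! ### Boxes, neighbourhoods and compactness -/

theorem eventually_exists_mem_skewBox (a : Λ.SkewArrow) :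
    ∀ᶠ N in Filter.atTop, ∃ lam mu, a ∈ skewBox N lam mu := by
  obtain ⟨p, q, h1, h2⟩ := a.hom.1.2
  have h0 : a.src.level = a.rng.level + a.hom.1.1 := a.hom.2
  have h : a ∈ skewBox (a.rng.level + toInt p) (a.rng.base.pre p) (a.src.base.pre q) :=
    mem_skewBox_pre rfl rfl h2 rfl (by rw [h0, h1]; abel)
  filter_upwards [Filter.eventually_ge_atTop (a.rng.level + toInt p)] with N hN
  exact exists_mem_skewBox_of_le hN h

theorem rng_level_eq {N : Fin k → ℤ} {lam mu : Λ.Path} {a b : Λ.SkewArrow}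
    (h : a ∈ skewBox N lam mu) (h' : b ∈ skewBox N lam mu) : a.rng.level = b.rng.level := by
  obtain ⟨-, -, -, h, -⟩ := h
  obtain ⟨-, -, -, h', -⟩ := h'
  exact add_right_cancel (h.trans h'.symm)

/-- Induction over the generated topology: a generator at a fixed level is itself a box, so nesting
applies, and finite intersections cost only a larger N. -/
theorem eventually_skewBox_subset_atLevel {U : Set (CatArrow Λ.InfinitePath)} (hU : IsOpen U)
    {a : Λ.SkewArrow} (ha : a ∈ atLevel Λ.canonicalCocycle U a.rng.level) :
    ∀ᶠ N in Filter.atTop, ∀ lam mu, a ∈ skewBox N lam mu →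
      skewBox N lam mu ⊆ atLevel Λ.canonicalCocycle U a.rng.level := by
  induction hU with
  | basic S hS =>
    obtain ⟨lam₀, mu₀, h, rfl⟩ := hS
    rw [← skewBox_eq_atLevel] at ha ⊢
    filter_upwards [Filter.eventually_ge_atTop _] with N hN lam mu hmem
    exact skewBox_subset hN ha hmem
  | univ =>
    exact .of_forall fun N lam mu h b hb => ⟨trivial, rng_level_eq hb h⟩
  | inter S T _ _ hS hT =>
    filter_upwards [hS ⟨ha.1.1, rfl⟩, hT ⟨ha.1.2, rfl⟩] with N h1 h2 lam mu hmem b hb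
    exact ⟨⟨(h1 lam mu hmem hb).1, (h2 lam mu hmem hb).1⟩, rng_level_eq hb hmem⟩
  | sUnion 𝒮 _ ih =>
    obtain ⟨⟨S, hS, haS⟩, -⟩ := ha
    filter_upwards [ih S hS ⟨haS, rfl⟩] with N h lam mu hmem b hb
    exact ⟨⟨S, hS, (h lam mu hmem hb).1⟩, rng_level_eq hb hmem⟩

theorem eventually_skewBox_subset {S : Set Λ.SkewArrow} (hS : IsOpen S) {a : Λ.SkewArrow}
    (ha : a ∈ S) : ∀ᶠ N in Filter.atTop, ∀ lam mu, a ∈ skewBox N lam mu →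
      skewBox N lam mu ⊆ S := by
  obtain ⟨U, hU, haU, hUS⟩ := exists_isOpen_atLevel_subset _ hS ha
  filter_upwards [eventually_skewBox_subset_atLevel hU haU] with N h lam mu hmem
  exact (h lam mu hmem).trans hUS

/-- A compact open set of arrows is a disjoint union of boxes of any sufficiently large level. -/
theorem eventually_exists_skewBox {W : Set Λ.SkewArrow} (hc : IsCompact W) (ho : IsOpen W) :
    ∀ᶠ N in Filter.atTop, ∀ a ∈ W, ∃ lam mu, a ∈ skewBox N lam mu ∧ skewBox N lam mu ⊆ W := by
  -- The property passes to subsets and finite unions of s, so compactness reduces it to a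
  -- neighbourhood of each point. A box inside W serves, as it contains every higher box that meets
  -- it.
  refine hc.induction_on (p := fun s => ∀ᶠ N in Filter.atTop, ∀ a ∈ s, ∃ lam mu,
    a ∈ skewBox N lam mu ∧ skewBox N lam mu ⊆ W) (by simp) (fun s t hst ht => ?_)
    (fun s t hs ht => ?_) (fun a ha => ?_)
  · filter_upwards [ht] with N h a ha using h a (hst ha)
  · filter_upwards [hs, ht] with N h1 h2 a ha using ha.elim (h1 a) (h2 a)
  · obtain ⟨N₀, ⟨lam, mu, h1⟩, h2⟩ :=
      ((eventually_exists_mem_skewBox a).and (eventually_skewBox_subset ho ha)).exists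
    refine ⟨skewBox N₀ lam mu, mem_nhdsWithin_of_mem_nhds
      ((isOpen_skewBox (src_eq_of_mem_skewBox h1) N₀).mem_nhds h1), ?_⟩
    filter_upwards [Filter.eventually_ge_atTop N₀] with N hN b hb
    obtain ⟨lam', mu', h3⟩ := exists_mem_skewBox_of_le hN hb
    exact ⟨lam', mu', h3, (skewBox_subset hN hb h3).trans (h2 lam mu h1)⟩

/-- Row-finiteness leaves finitely many choices for each initial segment of the range, so an
ultrafilter on the box selects one in each degree. These assemble to an infinite path, which
determines the limit arrow. -/
theorem isCompact_skewBox (hrf : Λ.RowFinite) {lam mu : Λ.Path} (h : lam.src = mu.src)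
    (N : Fin k → ℤ) : IsCompact (skewBox N lam mu) := by
  rw [isCompact_iff_ultrafilter_le_nhds]
  intro F hF
  have hbox : ∀ᶠ a in (F : Filter Λ.SkewArrow), a ∈ skewBox N lam mu :=
    Filter.le_principal_iff.1 hF
  have hex : ∀ m, ∃ α : Λ.Path, ∀ᶠ a in (F : Filter Λ.SkewArrow), a.rng.base.pre m = α := by
    intro m
    have : ∀ᶠ a in (F : Filter Λ.SkewArrow), ∃ α ∈ Λ.pathsTo lam.rng m,
        a.rng.base.pre m = α := by
      filter_upwards [hbox] with a ha
      refine ⟨_, ⟨?_, deg_pre _ _⟩, rfl⟩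
      rw [← ha.1, pre_rng, pre_rng]
    obtain ⟨α, -, hα⟩ := (Ultrafilter.eventually_exists_mem_iff (hrf lam.rng m)).1 this
    exact ⟨α, hα⟩
  choose f hf using hex
  obtain ⟨x, hx⟩ := exists_of_compatible f
    (fun m => by
      obtain ⟨a, ha⟩ := (hf m).exists
      rw [← ha, deg_pre])
    (fun m n hmn => by
      obtain ⟨a, h1, h2⟩ := ((hf m).and (hf n)).exists
      rw [← h1, ← h2]
      exact isInitial_pre _ hmn)
  have hxl : x.pre (Λ.deg lam) = lam := by
    obtain ⟨a, h1, h2⟩ := ((hf _).and hbox).exists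
    rw [hx, ← h1, h2.1]
  -- The source of the limit must be μ followed by the tail of x after λ.
  obtain ⟨y, hy, hy'⟩ := exists_concat (lam := mu) (z := x.shift (Λ.deg lam))
    (by rw [range_shift, hxl, h])
  obtain ⟨a₀, ha₀, hr, hs⟩ := exists_mem_skewBox hxl hy hy'.symm N
  refine ⟨a₀, ha₀, fun S hS => ?_⟩
  obtain ⟨T, hTS, hT, haT⟩ := mem_nhds_iff.1 hS
  obtain ⟨N', ⟨lam', mu', h1⟩, h2, hN⟩ := ((eventually_exists_mem_skewBox a₀).and
    ((eventually_skewBox_subset hT haT).and (Filter.eventually_ge_atTop N))).exists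
  suffices ∀ᶠ a in (F : Filter Λ.SkewArrow), a ∈ skewBox N' lam' mu' from
    this.mono fun a ha => hTS (h2 _ _ h1 ha)
  obtain ⟨h3, h4, h5, h6, h7⟩ := h1
  have hl := deg_eq_of_level ha₀.2.2.2.1 h6 hN
  have hm := deg_eq_of_level ha₀.2.2.2.2 h7 hN
  -- Within the original box, the range's initial segment of degree d(λ') alone decides membership
  -- in the smaller box.
  filter_upwards [hbox, hf (Λ.deg lam')] with a ha hfa
  obtain ⟨h3', h4', h5', h6', h7'⟩ := ha
  rw [← hx] at hfa
  have hra : a₀.rng.base = x := by rw [hr]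
  have hsa : a₀.src.base = y := by rw [hs]
  rw [hra] at h3
  rw [hsa] at h4
  refine ⟨hfa.trans h3, ?_, ?_, ?_, ?_⟩
  · rw [← h4, deg_pre, hm]
    refine pre_add_congr (h4'.trans hy.symm) ?_
    rw [hl] at hfa
    rw [← h5', hy', pre_shift_congr hfa]
  · rw [hl, hm, add_comm, ← shift_shift, h5', shift_shift, add_comm]
  · rw [hl, toInt_add, ← add_assoc, h6', add_toInt_natDiff hN]
  · rw [hm, toInt_add, ← add_assoc, h7', add_toInt_natDiff hN]

/-- A compact set contains only finitely many boxes of a level at which it is a union of boxes. -/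
theorem finite_skewBox_subset (hns : Λ.NoSources) {W : Set Λ.SkewArrow} (hc : IsCompact W)
    {N : Fin k → ℤ} (h : ∀ a ∈ W, ∃ lam mu, a ∈ skewBox N lam mu ∧ skewBox N lam mu ⊆ W) :
    {p : Λ.Path × Λ.Path | p.1.src = p.2.src ∧ skewBox N p.1 p.2 ⊆ W}.Finite := by
  obtain ⟨b, hb, hbf, hW⟩ := hc.elim_finite_subcover_image
    (b := {p : Λ.Path × Λ.Path | p.1.src = p.2.src ∧ skewBox N p.1 p.2 ⊆ W})
    (c := fun p => skewBox N p.1 p.2) (fun p hp => isOpen_skewBox hp.1 N) (fun a ha => by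
      obtain ⟨lam, mu, h1, h2⟩ := h a ha
      exact Set.mem_biUnion (x := (lam, mu)) ⟨src_eq_of_mem_skewBox h1, h2⟩ h1)
  -- A nonempty box inside W meets a box of the finite subcover, and boxes of one level that meet
  -- coincide.
  refine hbf.subset fun p hp => ?_
  obtain ⟨a, ha⟩ := skewBox_nonempty hns N hp.1
  obtain ⟨q, hq, haq⟩ := Set.mem_iUnion₂.1 (hW (hp.2 ha))
  rwa [Prod.ext (eq_of_mem_skewBox_of_rng_eq ha haq rfl) (eq_of_mem_skewBox_of_src_eq ha haq rfl)]

/-! ### Bisections in the skew product -/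

theorem injOn_src_of_subset_units {U : Set Λ.SkewArrow}
    (h : U ⊆ units (SkewProduct Λ.canonicalCocycle)) : Set.InjOn CatArrow.src U :=
  fun _ ha _ hb hab => skewArrow_ext hab <|
    (mem_units_iff.1 (h ha)).symm.trans (hab.trans (mem_units_iff.1 (h hb)))

theorem injOn_rng_of_subset_units {U : Set Λ.SkewArrow}
    (h : U ⊆ units (SkewProduct Λ.canonicalCocycle)) : Set.InjOn CatArrow.rng U :=
  fun _ ha _ hb hab => skewArrow_ext
    ((mem_units_iff.1 (h ha)).trans (hab.trans (mem_units_iff.1 (h hb)).symm)) hab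

/-- A compact open set of units as an idempotent compact open bisection. -/
def unitIdem (U : Set Λ.SkewArrow) (hc : IsCompact U) (ho : IsOpen U)
    (hu : U ⊆ units (SkewProduct Λ.canonicalCocycle)) : Idem (SkewProduct Λ.canonicalCocycle) where
  carrier := U
  isCompactOpenBisection :=
    ⟨hc, ho, injOn_src_of_subset_units hu, injOn_rng_of_subset_units hu⟩
  mul_self := (setMul_self_iff (injOn_src_of_subset_units hu) (injOn_rng_of_subset_units hu)).2 hu

theorem src_eq_rng_of_mem {x : Idem (SkewProduct Λ.canonicalCocycle)} {a : Λ.SkewArrow}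
    (ha : a ∈ x.carrier) : a.src = a.rng :=
  mem_units_iff.1 ((setMul_self_iff x.isCompactOpenBisection.injOn_src
    x.isCompactOpenBisection.injOn_rng).1 x.mul_self ha)

/-- Injectivity of the range on W collapses every product w⁻¹w' to the unit at the source of w. -/
theorem mem_setMul_setInv_left {W : Set Λ.SkewArrow} (hW : IsCompactOpenBisection W)
    {a : Λ.SkewArrow} :
    a ∈ setMul (setInv W) W ↔ a.src = a.rng ∧ ∃ w ∈ W, w.src = a.src := by
  constructor
  · rintro ⟨x, y, z, f, g, ⟨w, hw, h⟩, hg, rfl⟩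
    have h1 : y = w.rng := congrArg CatArrow.src h
    have h2 : z = w.src := congrArg CatArrow.rng h
    have h3 := hW.injOn_rng hg hw h1
    exact ⟨(congrArg CatArrow.src h3).trans h2.symm, _, hg, rfl⟩
  · rintro ⟨h, ⟨s, r, f⟩, hw, hs⟩
    refine ⟨s, r, s, Groupoid.inv f, f, ⟨_, hw, rfl⟩, hw, skewArrow_ext hs.symm ?_⟩
    exact h.symm.trans hs.symm

theorem mem_setMul_setInv_right {W : Set Λ.SkewArrow} (hW : IsCompactOpenBisection W)
    {a : Λ.SkewArrow} :
    a ∈ setMul W (setInv W) ↔ a.src = a.rng ∧ ∃ w ∈ W, w.rng = a.rng := by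
  constructor
  · rintro ⟨x, y, z, f, g, hf, ⟨w, hw, h⟩, rfl⟩
    have h1 : y = w.src := congrArg CatArrow.rng h
    have h2 : x = w.rng := congrArg CatArrow.src h
    have h3 := hW.injOn_src hf hw h1
    exact ⟨h2.trans (congrArg CatArrow.rng h3).symm, _, hf, rfl⟩
  · rintro ⟨h, ⟨s, r, f⟩, hw, hr⟩
    refine ⟨r, s, r, f, Groupoid.inv f, hw, ⟨_, hw, rfl⟩, skewArrow_ext ?_ hr.symm⟩
    exact h.trans hr.symm

theorem disjoint_of_setMul_eq_empty {x y : Idem (SkewProduct Λ.canonicalCocycle)}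
    (h : setMul (setInv x.carrier) y.carrier = ∅) : Disjoint x.carrier y.carrier := by
  refine Set.disjoint_left.2 fun a hx hy => ?_
  have : (⟨a.src, a.src, a.hom ≫ Groupoid.inv a.hom⟩ : Λ.SkewArrow)
      ∈ setMul (setInv x.carrier) y.carrier :=
    ⟨_, _, _, Groupoid.inv a.hom, a.hom, ⟨a, hx, rfl⟩, hy, rfl⟩
  rwa [h] at this

theorem setMul_eq_empty_of_disjoint {x y : Idem (SkewProduct Λ.canonicalCocycle)}
    (h : Disjoint x.carrier y.carrier) :
    setMul (setInv x.carrier) y.carrier = ∅ ∧ setMul x.carrier (setInv y.carrier) = ∅ := by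
  constructor <;> refine Set.eq_empty_of_forall_notMem ?_
  · rintro _ ⟨p, q, r, f, g, ⟨w, hw, h1⟩, hg, rfl⟩
    have h2 : q = w.rng := congrArg CatArrow.src h1
    have h3 : p = q := src_eq_rng_of_mem hg
    refine Set.disjoint_left.1 h hw ?_
    rwa [show w = ⟨p, q, g⟩ from skewArrow_ext
      ((src_eq_rng_of_mem hw).trans (h2.symm.trans h3.symm)) h2.symm]
  · rintro _ ⟨p, q, r, f, g, hf, ⟨w, hw, h1⟩, rfl⟩
    have h2 : q = w.src := congrArg CatArrow.rng h1
    have h3 : q = r := src_eq_rng_of_mem hf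
    refine Set.disjoint_left.1 h hf ?_
    rwa [show (⟨q, r, f⟩ : Λ.SkewArrow) = w from skewArrow_ext h2
      (h3.symm.trans (h2.trans (src_eq_rng_of_mem hw)))]

/-! ### Boxes as bisections -/

theorem skewBox_subset_units (N : Fin k → ℤ) (lam : Λ.Path) :
    skewBox N lam lam ⊆ units (SkewProduct Λ.canonicalCocycle) := by
  rintro a ⟨h1, h2, h3, h4, h5⟩
  exact mem_units_iff.2 (SkewProduct.ext (eq_of_pre_eq_of_shift_eq (h2.trans h1.symm) h3.symm)
    (add_right_cancel (h5.trans h4.symm)))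

theorem eq_of_mem_skewBox_of_unit {N : Fin k → ℤ} {lam mu : Λ.Path} {a : Λ.SkewArrow}
    (ha : a.src = a.rng) (h : a ∈ skewBox N lam mu) : lam = mu := by
  obtain ⟨h1, h2, -, h4, h5⟩ := h
  rw [ha] at h2 h5
  rw [← h1, ← h2, deg_eq_of_level_eq h4 h5]

/-- Either end of an arrow determines the common tail, and prefixing the other path recovers the
other end. -/
theorem isCompactOpenBisection_skewBox (hrf : Λ.RowFinite) {lam mu : Λ.Path}
    (h : lam.src = mu.src) (N : Fin k → ℤ) : IsCompactOpenBisection (skewBox N lam mu) where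
  isCompact := isCompact_skewBox hrf h N
  isOpen := isOpen_skewBox h N
  injOn_src := fun a ha b hb hab => skewArrow_ext hab <| SkewProduct.ext
    (eq_of_pre_eq_of_shift_eq (ha.1.trans hb.1.symm) (by rw [ha.2.2.1, hb.2.2.1, hab]))
    (rng_level_eq ha hb)
  injOn_rng := fun a ha b hb hab => skewArrow_ext (SkewProduct.ext
    (eq_of_pre_eq_of_shift_eq (ha.2.1.trans hb.2.1.symm) (by rw [← ha.2.2.1, ← hb.2.2.1, hab]))
    (add_right_cancel (ha.2.2.2.2.trans hb.2.2.2.2.symm))) hab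

theorem exists_mem_skewBox_src_eq {N : Fin k → ℤ} {lam mu nu : Λ.Path} {b : Λ.SkewArrow}
    (h : lam.src = mu.src) (hb : b ∈ skewBox N nu mu) : ∃ w ∈ skewBox N lam mu, w.src = b.src := by
  obtain ⟨-, h2, -, -, h5⟩ := hb
  obtain ⟨x, hx, hx'⟩ := exists_concat (lam := lam) (z := b.src.base.shift (Λ.deg mu))
    (by rw [range_shift, h2, h])
  obtain ⟨w, hw, -, hs⟩ := exists_mem_skewBox hx h2 hx' N
  exact ⟨w, hw, by rw [hs, ← h5, add_sub_cancel_right]⟩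

theorem exists_mem_skewBox_rng_eq {N : Fin k → ℤ} {lam mu nu : Λ.Path} {b : Λ.SkewArrow}
    (h : lam.src = mu.src) (hb : b ∈ skewBox N lam nu) : ∃ w ∈ skewBox N lam mu, w.rng = b.rng := by
  obtain ⟨h1, -, -, h4, -⟩ := hb
  obtain ⟨y, hy, hy'⟩ := exists_concat (lam := mu) (z := b.rng.base.shift (Λ.deg lam))
    (by rw [range_shift, h1, h])
  obtain ⟨w, hw, hr, -⟩ := exists_mem_skewBox h1 hy hy'.symm N
  exact ⟨w, hw, by rw [hr, ← h4, add_sub_cancel_right]⟩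

theorem mem_skewBox_diag_iff {N : Fin k → ℤ} {lam : Λ.Path} {a : Λ.SkewArrow} :
    a ∈ skewBox N lam lam ↔ a.src = a.rng ∧ a.rng.base.pre (Λ.deg lam) = lam ∧
      a.rng.level + toInt (Λ.deg lam) = N := by
  constructor
  · exact fun h => ⟨mem_units_iff.1 (skewBox_subset_units _ _ h), h.1, h.2.2.2.1⟩
  · rintro ⟨h, h1, h2⟩
    exact ⟨h1, by rw [h, h1], by rw [h], h2, by rw [h, h2]⟩

theorem mem_skewBox_diag_of_src {N : Fin k → ℤ} {lam mu : Λ.Path} {a w : Λ.SkewArrow}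
    (ha : a.src = a.rng) (hw : w ∈ skewBox N lam mu) (h : w.src = a.src) :
    a ∈ skewBox N mu mu := by
  obtain ⟨-, h2, -, -, h5⟩ := hw
  rw [h, ha] at h2 h5
  exact mem_skewBox_diag_iff.2 ⟨ha, h2, h5⟩

theorem mem_skewBox_diag_of_rng {N : Fin k → ℤ} {lam mu : Λ.Path} {a w : Λ.SkewArrow}
    (ha : a.src = a.rng) (hw : w ∈ skewBox N lam mu) (h : w.rng = a.rng) :
    a ∈ skewBox N lam lam := by
  obtain ⟨h1, -, -, h4, -⟩ := hw
  rw [h] at h1 h4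
  exact mem_skewBox_diag_iff.2 ⟨ha, h1, h4⟩

theorem setMul_setInv_skewBox_left (hrf : Λ.RowFinite) {lam mu : Λ.Path} (h : lam.src = mu.src)
    (N : Fin k → ℤ) :
    setMul (setInv (skewBox N lam mu)) (skewBox N lam mu) = skewBox N mu mu := by
  ext a
  rw [mem_setMul_setInv_left (isCompactOpenBisection_skewBox hrf h N)]
  constructor
  · rintro ⟨ha, w, hw, hwa⟩
    exact mem_skewBox_diag_of_src ha hw hwa
  · intro ha
    exact ⟨(mem_skewBox_diag_iff.1 ha).1, exists_mem_skewBox_src_eq h ha⟩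

theorem setMul_setInv_skewBox_right (hrf : Λ.RowFinite) {lam mu : Λ.Path} (h : lam.src = mu.src)
    (N : Fin k → ℤ) :
    setMul (skewBox N lam mu) (setInv (skewBox N lam mu)) = skewBox N lam lam := by
  ext a
  rw [mem_setMul_setInv_right (isCompactOpenBisection_skewBox hrf h N)]
  constructor
  · rintro ⟨ha, w, hw, hwa⟩
    exact mem_skewBox_diag_of_rng ha hw hwa
  · intro ha
    exact ⟨(mem_skewBox_diag_iff.1 ha).1, exists_mem_skewBox_rng_eq h ha⟩

/-- The compact open set of units `Z(λ) × {N - d(λ)}`. -/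
def boxIdem (hrf : Λ.RowFinite) (N : Fin k → ℤ) (lam : Λ.Path) :
    Idem (SkewProduct Λ.canonicalCocycle) :=
  unitIdem (skewBox N lam lam) (isCompact_skewBox hrf rfl N) (isOpen_skewBox rfl N)
    (skewBox_subset_units N lam)

theorem carrier_boxIdem_vertexPath (hrf : Λ.RowFinite) (n : Fin k → ℤ) (v : Λ.Obj) :
    (boxIdem hrf n (Λ.vertexPath v)).carrier
      = atLevel Λ.canonicalCocycle (vertexCylinder v) n := by
  have := skewBox_eq_atLevel (Λ.vertexPath v) (Λ.vertexPath v) n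
  rwa [deg_vertexPath, toInt_zero, add_zero] at this

/-- Infinite paths from v are sorted by their initial segment of degree N - n; for N = n + e_i this
is the talented relation. -/
theorem skewBox_vertexPath_eq (hrf : Λ.RowFinite) {n N : Fin k → ℤ} (h : n ≤ N) (v : Λ.Obj) :
    skewBox n (Λ.vertexPath v) (Λ.vertexPath v)
      = ⋃ α ∈ pathFinset hrf v (natDiff N n), skewBox N α α := by
  ext a
  rw [mem_skewBox_diag_iff, Set.mem_iUnion₂, deg_vertexPath, toInt_zero, add_zero]
  constructor
  · rintro ⟨h1, h2, h3⟩
    refine ⟨a.rng.base.pre (natDiff N n), mem_pathFinset.2 ⟨?_, deg_pre _ _⟩, ?_⟩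
    · exact congrArg CatArrow.rng h2
    · rw [mem_skewBox_diag_iff, deg_pre, h3, add_toInt_natDiff h]
      exact ⟨h1, rfl, rfl⟩
  · rintro ⟨α, hα, ha⟩
    rw [mem_skewBox_diag_iff] at ha
    rw [mem_pathFinset] at hα
    obtain ⟨h1, h2, h3⟩ := ha
    obtain ⟨rfl, hd⟩ := hα
    refine ⟨h1, ?_, ?_⟩
    · rw [eq_vertexPath_of_deg (deg_pre _ _), ← h2]
      rfl
    · rw [hd] at h3
      exact add_right_cancel (h3.trans (add_toInt_natDiff h).symm)

/-! ### Computations in the type monoid -/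

theorem typ_eq_zero {x : Idem (SkewProduct Λ.canonicalCocycle)} (hx : x.carrier = ∅) :
    typ x = 0 :=
  (Presented.mk_eq_of_rel (TypRel.zero x hx)).trans (map_zero _)

theorem typ_eq_add {x y z : Idem (SkewProduct Λ.canonicalCocycle)}
    (h : Disjoint x.carrier y.carrier) (hz : z.carrier = x.carrier ∪ y.carrier) :
    typ z = typ x + typ y :=
  (Presented.mk_eq_of_rel (TypRel.join x y z (setMul_eq_empty_of_disjoint h).1
    (setMul_eq_empty_of_disjoint h).2 hz)).trans (map_add _ _ _)

/-- The bisection Z(λ, s(λ)) at level N, which removes the prefix λ, links the two sets of units. -/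
theorem typ_boxIdem (hrf : Λ.RowFinite) (N : Fin k → ℤ) (lam : Λ.Path) :
    typ (boxIdem hrf N lam) = typ (boxIdem hrf N (Λ.vertexPath lam.src)) := by
  have h : lam.src = (Λ.vertexPath lam.src).src := rfl
  exact (Presented.mk_eq_of_rel (TypRel.equiv (boxIdem hrf N (Λ.vertexPath lam.src))
    (boxIdem hrf N lam) (skewBox N lam (Λ.vertexPath lam.src))
    (isCompactOpenBisection_skewBox hrf h N)
    (setMul_setInv_skewBox_left hrf h N).symm (setMul_setInv_skewBox_right hrf h N).symm)).symm

theorem typ_eq_sum (hrf : Λ.RowFinite) (N : Fin k → ℤ) (S : Finset Λ.Path) :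
    ∀ x : Idem (SkewProduct Λ.canonicalCocycle), x.carrier = ⋃ α ∈ S, skewBox N α α →
      typ x = ∑ α ∈ S, typ (boxIdem hrf N (Λ.vertexPath α.src)) := by
  classical
  induction S using Finset.induction_on with
  | empty =>
    intro x hx
    rw [Finset.sum_empty]
    exact typ_eq_zero (by simpa using hx)
  | insert α S hα ih =>
    intro x hx
    let y := unitIdem (⋃ β ∈ S, skewBox N β β)
      (S.finite_toSet.isCompact_biUnion fun β _ => isCompact_skewBox hrf rfl N)
      (isOpen_biUnion fun β _ => isOpen_skewBox rfl N)
      (Set.iUnion₂_subset fun β _ => skewBox_subset_units N β)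
    rw [Finset.sum_insert hα, ← ih y rfl, ← typ_boxIdem]
    refine typ_eq_add ?_ (hx.trans (Finset.set_biUnion_insert _ _ _))
    refine Set.disjoint_left.2 fun a ha ha' => ?_
    obtain ⟨β, hβ, hab⟩ := Set.mem_iUnion₂.1 ha'
    rw [eq_of_mem_skewBox_of_rng_eq ha hab rfl] at hα
    exact hα hβ

/-- The homomorphism from the talented monoid to the graded type monoid. -/
noncomputable def talentedToTyp (hrf : Λ.RowFinite) :
    Λ.TalentedMonoid →+ GradedTypeMonoid Λ.canonicalCocycle :=
  Presented.lift _ (fun p => typ (boxIdem hrf p.2 (Λ.vertexPath p.1))) <| by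
    rintro _ _ ⟨v, n, i, S, hS, -⟩
    obtain rfl : S = pathFinset hrf v (Pi.single i 1) := by
      ext α
      rw [← Finset.mem_coe, hS, mem_pathFinset]
      rfl
    rw [map_sum]
    simp only [freeLift_single]
    refine typ_eq_sum hrf _ _ _ ?_
    have h : n ≤ n + Pi.single i 1 := by
      rw [← toInt_single]
      exact le_add_of_nonneg_right (toInt_nonneg _)
    have h' := skewBox_vertexPath_eq hrf h v
    rwa [natDiff_eq (m := Pi.single i 1) (by rw [toInt_single])] at h'

theorem talentedToTyp_gen (hrf : Λ.RowFinite) (v : Λ.Obj) (n : Fin k → ℤ) :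
    talentedToTyp hrf (Λ.gen v n) = typ (boxIdem hrf n (Λ.vertexPath v)) :=
  Presented.lift_of _ _ _ _

/-! ### The germ of a compact open set of units -/

/-- The paths `λ` such that `Z(λ) × {N - d(λ)}` is contained in `U`. -/
def unitPaths (N : Fin k → ℤ) (U : Set Λ.SkewArrow) : Set Λ.Path := {lam | skewBox N lam lam ⊆ U}

/-- A box containing a unit is diagonal, so the decomposition of a compact open set of units
involves only boxes Z(λ, λ). -/
theorem eventually_eq_iUnion_unitPaths (hns : Λ.NoSources)
    (x : Idem (SkewProduct Λ.canonicalCocycle)) :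
    ∀ᶠ N in Filter.atTop, (unitPaths N x.carrier).Finite ∧
      x.carrier = ⋃ α ∈ unitPaths N x.carrier, skewBox N α α := by
  have hx := x.isCompactOpenBisection
  filter_upwards [eventually_exists_skewBox hx.isCompact hx.isOpen] with N hN
  refine ⟨((finite_skewBox_subset hns hx.isCompact hN).image Prod.fst).subset
    fun α hα => ⟨(α, α), ⟨rfl, hα⟩, rfl⟩, Set.Subset.antisymm (fun a ha => ?_)
    (Set.iUnion₂_subset fun α hα => hα)⟩
  obtain ⟨lam, mu, h1, h2⟩ := hN a ha
  obtain rfl := eq_of_mem_skewBox_of_unit (src_eq_rng_of_mem ha) h1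
  exact Set.mem_biUnion (x := lam) h2 h1

/-- Boxes Z(λ, λ) of one level are nonempty and disjoint for different λ, so none hides in a union
of others. -/
theorem unitPaths_biUnion (hns : Λ.NoSources) (N : Fin k → ℤ) (S : Set Λ.Path) :
    unitPaths N (⋃ α ∈ S, skewBox N α α) = S := by
  refine Set.Subset.antisymm (fun lam hlam => ?_) fun α hα =>
    Set.subset_biUnion_of_mem (u := fun α => skewBox N α α) hα
  obtain ⟨a, ha⟩ := skewBox_nonempty hns N (rfl : lam.src = lam.src)
  obtain ⟨α, hα, haα⟩ := Set.mem_iUnion₂.1 (hlam ha)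
  rwa [eq_of_mem_skewBox_of_rng_eq ha haα rfl]

/-- The sources of the paths in `unitPaths N U`, counted with multiplicity. -/
noncomputable def unitCount (N : Fin k → ℤ) (U : Set Λ.SkewArrow) : Λ.Obj →₀ ℕ :=
  ∑ᶠ α ∈ unitPaths N U, Finsupp.single α.src 1

theorem unitCount_empty (hns : Λ.NoSources) (N : Fin k → ℤ) :
    unitCount N (∅ : Set Λ.SkewArrow) = 0 := by
  have h := unitPaths_biUnion hns N ∅
  rw [Set.biUnion_empty] at h
  rw [unitCount, h, finsum_mem_empty]

/-- At large levels the paths for the union are the disjoint union of the two finite sets of paths.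
Finiteness, needed to split the `finsum`, is only known for large N. -/
theorem eventually_unitCount_union (hns : Λ.NoSources)
    {x y z : Idem (SkewProduct Λ.canonicalCocycle)} (h : Disjoint x.carrier y.carrier)
    (hz : z.carrier = x.carrier ∪ y.carrier) : ∀ᶠ N in Filter.atTop,
      unitCount N z.carrier = unitCount N x.carrier + unitCount N y.carrier := by
  filter_upwards [eventually_eq_iUnion_unitPaths hns x, eventually_eq_iUnion_unitPaths hns y]
    with N ⟨hxf, hx⟩ ⟨hyf, hy⟩
  have hu : unitPaths N z.carrier = unitPaths N x.carrier ∪ unitPaths N y.carrier := by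
    conv_lhs => rw [hz, hx, hy, ← Set.biUnion_union]
    exact unitPaths_biUnion hns N _
  have hd : Disjoint (unitPaths N x.carrier) (unitPaths N y.carrier) := by
    refine Set.disjoint_left.2 fun α hα hα' => ?_
    obtain ⟨a, ha⟩ := skewBox_nonempty hns N (rfl : α.src = α.src)
    exact Set.disjoint_left.1 h (hα ha) (hα' ha)
  rw [unitCount, hu, finsum_mem_union hd hxf hyf]
  rfl

/-- At a large level W is a union of boxes Z(λ, μ). Each contributes Z(μ) to W⁻¹W and Z(λ) to WW⁻¹,
and s(λ) = s(μ) makes the counts equal. -/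
theorem eventually_unitCount_equiv (hns : Λ.NoSources) {W : Set Λ.SkewArrow}
    (hW : IsCompactOpenBisection W) : ∀ᶠ N in Filter.atTop,
      unitCount N (setMul (setInv W) W) = unitCount N (setMul W (setInv W)) := by
  filter_upwards [eventually_exists_skewBox hW.isCompact hW.isOpen] with N hN
  let P : Set (Λ.Path × Λ.Path) := {p | p.1.src = p.2.src ∧ skewBox N p.1 p.2 ⊆ W}
  have hs : Set.BijOn Prod.snd P (unitPaths N (setMul (setInv W) W)) := by
    refine ⟨?_, ?_, ?_⟩
    · rintro ⟨lam, mu⟩ ⟨h1, h2⟩ a ha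
      rw [mem_setMul_setInv_left hW]
      obtain ⟨w, hw, hwa⟩ := exists_mem_skewBox_src_eq h1 ha
      exact ⟨(mem_skewBox_diag_iff.1 ha).1, w, h2 hw, hwa⟩
    -- Two boxes in W with the same μ contain arrows with a common source; as W is a bisection the
    -- arrows coincide, hence so do the boxes.
    · rintro ⟨lam, mu⟩ ⟨h1, h2⟩ ⟨lam', mu'⟩ ⟨h1', h2'⟩ (rfl : mu = mu')
      obtain ⟨a, ha⟩ := skewBox_nonempty hns N h1
      obtain ⟨b, hb, hab⟩ := exists_mem_skewBox_src_eq h1' ha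
      have := hW.injOn_src (h2' hb) (h2 ha) hab
      exact Prod.ext (eq_of_mem_skewBox_of_rng_eq ha hb (by rw [this])) rfl
    · intro mu hmu
      obtain ⟨a, ha⟩ := skewBox_nonempty hns N (rfl : mu.src = mu.src)
      obtain ⟨-, w, hw, hwa⟩ := (mem_setMul_setInv_left hW).1 (hmu ha)
      obtain ⟨lam, mu', h1, h2⟩ := hN w hw
      exact ⟨(lam, mu'), ⟨src_eq_of_mem_skewBox h1, h2⟩, eq_of_mem_skewBox_of_src_eq h1 ha hwa⟩
  have hr : Set.BijOn Prod.fst P (unitPaths N (setMul W (setInv W))) := by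
    refine ⟨?_, ?_, ?_⟩
    · rintro ⟨lam, mu⟩ ⟨h1, h2⟩ a ha
      rw [mem_setMul_setInv_right hW]
      obtain ⟨w, hw, hwa⟩ := exists_mem_skewBox_rng_eq h1 ha
      exact ⟨(mem_skewBox_diag_iff.1 ha).1, w, h2 hw, hwa⟩
    · rintro ⟨lam, mu⟩ ⟨h1, h2⟩ ⟨lam', mu'⟩ ⟨h1', h2'⟩ (rfl : lam = lam')
      obtain ⟨a, ha⟩ := skewBox_nonempty hns N h1
      obtain ⟨b, hb, hab⟩ := exists_mem_skewBox_rng_eq h1' ha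
      have := hW.injOn_rng (h2' hb) (h2 ha) hab
      exact Prod.ext rfl (eq_of_mem_skewBox_of_src_eq ha hb (by rw [this]))
    · intro lam hlam
      obtain ⟨a, ha⟩ := skewBox_nonempty hns N (rfl : lam.src = lam.src)
      obtain ⟨-, w, hw, hwa⟩ := (mem_setMul_setInv_right hW).1 (hlam ha)
      obtain ⟨lam', mu, h1, h2⟩ := hN w hw
      exact ⟨(lam', mu), ⟨src_eq_of_mem_skewBox h1, h2⟩, eq_of_mem_skewBox_of_rng_eq h1 ha hwa⟩
  rw [unitCount, unitCount, ← finsum_mem_eq_of_bijOn _ hs fun p _ => rfl]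
  exact finsum_mem_eq_of_bijOn _ hr fun p hp => by rw [hp.1]

/-- The homomorphism from the graded type monoid to the monoid of germs. -/
noncomputable def typGerm (hns : Λ.NoSources) :
    GradedTypeMonoid Λ.canonicalCocycle →+ VertexGerm Λ :=
  Presented.lift _ (fun x => germHom Λ (fun N => unitCount N x.carrier)) <| by
    intro a b h
    cases h with
    | zero x hx =>
      rw [freeLift_single, map_zero, ← map_zero (germHom Λ), germHom_eq]
      exact .of_forall fun N => by rw [hx, unitCount_empty hns]; rfl
    | equiv x y W hW hx hy =>
      rw [freeLift_single, freeLift_single, germHom_eq, hx, hy]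
      exact eventually_unitCount_equiv hns hW
    | join x y z h h' hz =>
      rw [map_add, freeLift_single, freeLift_single, freeLift_single, ← map_add, germHom_eq]
      exact eventually_unitCount_union hns (disjoint_of_setMul_eq_empty h) hz

theorem typGerm_typ (hns : Λ.NoSources) (x : Idem (SkewProduct Λ.canonicalCocycle)) :
    typGerm hns (typ x) = germHom Λ (fun N => unitCount N x.carrier) :=
  Presented.lift_of _ _ _ _

/-- For N ≥ n the boxes of level N inside Z(v) × {n} are indexed by vΛ^{N-n}, the very set summed
over in `pushGen`. -/
theorem typGerm_comp_talentedToTyp (hrf : Λ.RowFinite) (hns : Λ.NoSources) :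
    (typGerm hns).comp (talentedToTyp hrf) = talentedGerm hrf := by
  refine Presented.hom_ext ?_
  rintro ⟨v, n⟩
  change typGerm hns (talentedToTyp hrf (Λ.gen v n)) = talentedGerm hrf (Λ.gen v n)
  rw [talentedToTyp_gen, typGerm_typ, talentedGerm_gen, germHom_eq]
  filter_upwards [Filter.eventually_ge_atTop n] with N hN
  have h : unitPaths N (boxIdem hrf n (Λ.vertexPath v)).carrier
      = pathFinset hrf v (natDiff N n) := by
    change unitPaths N (skewBox n (Λ.vertexPath v) (Λ.vertexPath v)) = _
    rw [skewBox_vertexPath_eq hrf hN v]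
    exact unitPaths_biUnion hns N _
  rw [unitCount, h, finsum_mem_coe_finset]
  rfl

/-! ### Bijectivity and equivariance -/

theorem talentedToTyp_injective (hrf : Λ.RowFinite) (hns : Λ.NoSources) :
    Function.Injective (talentedToTyp hrf) := by
  have h := talentedGerm_injective hrf hns
  rw [← typGerm_comp_talentedToTyp hrf hns, AddMonoidHom.coe_comp] at h
  exact h.of_comp

/-- At a large level the set is a finite disjoint union of diagonal boxes, whose types are images of
generators s(α)(N). -/
theorem typ_mem_mrange (hrf : Λ.RowFinite) (hns : Λ.NoSources)
    (x : Idem (SkewProduct Λ.canonicalCocycle)) :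
    typ x ∈ AddMonoidHom.mrange (talentedToTyp hrf) := by
  obtain ⟨N, hf, hx⟩ := (eventually_eq_iUnion_unitPaths hns x).exists
  rw [typ_eq_sum hrf N hf.toFinset x (by simpa using hx)]
  exact sum_mem fun α _ => ⟨_, talentedToTyp_gen hrf _ _⟩

theorem talentedToTyp_surjective (hrf : Λ.RowFinite) (hns : Λ.NoSources) :
    Function.Surjective (talentedToTyp hrf) := by
  intro b
  obtain ⟨x, rfl⟩ := Presented.mk_surjective _ b
  change _ ∈ AddMonoidHom.mrange (talentedToTyp hrf)
  rw [Presented.mk_eq_freeLift]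
  induction x using Finsupp.induction_linear with
  | zero => rw [map_zero]; exact zero_mem _
  | add x y hx hy => rw [map_add]; exact add_mem hx hy
  | single g c =>
    rw [show Finsupp.single g c = c • Finsupp.single g 1 by simp, map_nsmul, freeLift_single]
    exact nsmul_mem (typ_mem_mrange hrf hns g) c

theorem smul_gen (m : Multiplicative (Fin k → ℤ)) (v : Λ.Obj) (n : Fin k → ℤ) :
    m • Λ.gen v n = Λ.gen v (n + m.toAdd) := by
  change Presented.mk _ (Finsupp.mapDomain _ (Finsupp.single _ _)) = _
  rw [Finsupp.mapDomain_single]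
  rfl

theorem smul_typ (m : Multiplicative (Fin k → ℤ)) (x : Idem (SkewProduct Λ.canonicalCocycle)) :
    m • typ x = typ (m • x) := by
  change Presented.mk _ (Finsupp.mapDomain _ (Finsupp.single _ _)) = _
  rw [Finsupp.mapDomain_single]
  rfl

theorem smul_boxIdem_vertexPath (hrf : Λ.RowFinite) (m : Multiplicative (Fin k → ℤ))
    (n : Fin k → ℤ) (v : Λ.Obj) : m • boxIdem hrf n (Λ.vertexPath v)
      = boxIdem hrf (n + m.toAdd) (Λ.vertexPath v) := by
  ext1
  rw [Idem.carrier_smul, carrier_boxIdem_vertexPath, carrier_boxIdem_vertexPath,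
    image_translate_atLevel, add_comm]

theorem talentedToTyp_smul (hrf : Λ.RowFinite) (m : Multiplicative (Fin k → ℤ))
    (a : Λ.TalentedMonoid) : talentedToTyp hrf (m • a) = m • talentedToTyp hrf a := by
  have h : (talentedToTyp hrf).comp (DistribSMul.toAddMonoidHom _ m)
      = (DistribSMul.toAddMonoidHom _ m).comp (talentedToTyp hrf) := by
    refine Presented.hom_ext ?_
    rintro ⟨v, n⟩
    change talentedToTyp hrf (m • Λ.gen v n) = m • talentedToTyp hrf (Λ.gen v n)
    rw [smul_gen, talentedToTyp_gen, talentedToTyp_gen, smul_typ, smul_boxIdem_vertexPath]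
  exact DFunLike.congr_fun h a

end KGraph

end HRG

theorem mainTheorem1 {k : ℕ} (Λ : HRG.KGraph.{u} k) (hrf : Λ.RowFinite) (hns : Λ.NoSources) :
    (∃ φ : Λ.TalentedMonoid ≃+ HRG.GradedTypeMonoid Λ.canonicalCocycle,
      (∀ (v : Λ.Obj) (n : Fin k → ℤ),
        ∃ U : HRG.Idem (HRG.SkewProduct Λ.canonicalCocycle),
          U.carrier = HRG.atLevel Λ.canonicalCocycle (HRG.KGraph.vertexCylinder v) n ∧
          φ (Λ.gen v n) = HRG.typ U) ∧
      (∀ (m : Multiplicative (Fin k → ℤ)) (a : Λ.TalentedMonoid), φ (m • a) = m • φ a)) ∧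
    HRG.IsConical Λ.TalentedMonoid ∧ HRG.IsRefinement Λ.TalentedMonoid :=
  ⟨⟨AddEquiv.ofBijective (HRG.KGraph.talentedToTyp hrf)
    ⟨HRG.KGraph.talentedToTyp_injective hrf hns, HRG.KGraph.talentedToTyp_surjective hrf hns⟩,
    fun v n => ⟨_, HRG.KGraph.carrier_boxIdem_vertexPath hrf n v,
      HRG.KGraph.talentedToTyp_gen hrf v n⟩,
    HRG.KGraph.talentedToTyp_smul hrf⟩,
    HRG.KGraph.isConical_talentedMonoid hrf hns, HRG.KGraph.isRefinement_talentedMonoid hrf hns⟩
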